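/- For integers $N\ge 1$, $M\ge 1$ and $x,y\in\mathbb{R}$ let $$\widetilde K_N(x,y)=\int_{c-i\infty}^{c+i\infty}\frac{ds}{2\pi i}\oint_{\Sigma}\frac{dt}{2\pi i}\,\frac{e^{xt-ys}}{s-t}\,\frac{\Gamma(t)}{\Gamma(s)}\left(\frac{\Gamma(s+N)}{\Gamma(t+N)}\right)^{M+1},$$ where $\Sigma$ is a counter-clockwise contour encircling $0,-1,\dots,-N+1$ and the vertical line $\Re s=c$ is disjoint from $\Sigma$; for definiteness, $\Sigma$ is the circle with diameter $[-N+\tfrac12,\tfrac12]$ and $c=1$. With $\psi=\Gamma'/\Gamma$, and for $k\in\mathbb{N}=\{1,2,\dots\}$, $N\ge k$ and $\xi\in\mathbb{R}$, let $$x_N(k)=N\big(\psi(1-k+N)-\log N\big),\qquad g(k;\xi)=N\log N+x_N(k)+\xi\sqrt{\frac{N}{M+1}} .$$ **Theorem.** Let $\epsilon>0$. 1. There exists $C_0=C_0(\epsilon)>0$ such that for every sequence $M=M(N)$ of non-negative integers with $\lim_{N\to\infty}M/N=\infty$ and all sufficiently large $N$, the function $x\mapsto\widetilde K_N(x,x)$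 is integrable on the half-line below and $$\int_{\frac{M+1}{N}g(1;C_0)}^{+\infty}\widetilde K_N(x,x)\,dx<\epsilon .$$ 2. For each fixed $k\in\mathbb{N}$ there exists $C_k=C_k(\epsilon)>0$ such that for every sequence $M=M(N)$ of non-negative integers with $\lim_{N\to\infty}M/N=\infty$ and all sufficiently large $N$, the function $x\mapsto\widetilde K_N(x,x)$ is integrable on the interval below and $$\int_{\frac{M+1}{N}g(k+1;C_k)}^{\frac{M+1}{N}g(k;-C_k)}\widetilde K_N(x,x)\,dx<\epsilon .$$ -/

import Mathlib

open Filter MeasureTheory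

noncomputable section

namespace GinibreProduct

/-- The integrand
`e^{x t - y s} / (s - t) * Γ(t) / Γ(s) * (Γ(s + N) / Γ(t + N))^{M + 1}`
of the double contour integral defining the correlation kernel. -/
def kernelIntegrand (N M : ℕ) (x y : ℝ) (s t : ℂ) : ℂ :=
  Complex.exp (x * t - y * s) / (s - t) * (Complex.Gamma t / Complex.Gamma s) *
    (Complex.Gamma (s + N) / Complex.Gamma (t + N)) ^ (M + 1)

/-- The correlation kernel
`∫_{c - i∞}^{c + i∞} ds/(2πi) ∮_Σ dt/(2πi) (integrand)`,
as a complex number. The contour `Σ` is the counter-clockwise circle with diameter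
`[-N + 1/2, 1/2]`, which encircles `0, -1, …, -N + 1`, and `c = 1`, so that the vertical line
`s = 1 + i v` (with `ds = i dv`) is disjoint from `Σ`. -/
def kernelC (N M : ℕ) (x y : ℝ) : ℂ :=
  (2 * Real.pi * Complex.I)⁻¹ * ∫ v : ℝ,
    ((2 * Real.pi * Complex.I)⁻¹ *
      ∮ t in C((1 - N) / 2, N / 2), kernelIntegrand N M x y (1 + v * Complex.I) t) * Complex.I

open ComplexConjugate in
lemma conj_kernelIntegrand (N M : ℕ) (x y : ℝ) (s t : ℂ) :
    conj (kernelIntegrand N M x y s t) = kernelIntegrand N M x y (conj s) (conj t) := by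
  simp [kernelIntegrand, ← Complex.exp_conj, ← Complex.Gamma_conj]

open ComplexConjugate in
/-- The kernel is real: it is invariant under complex conjugation. -/
lemma conj_kernelC (N M : ℕ) (x y : ℝ) : conj (kernelC N M x y) = kernelC N M x y := by
  have key : ∀ s : ℂ,
      conj ((2 * Real.pi * Complex.I)⁻¹ *
        ∮ t in C((1 - N) / 2, N / 2), kernelIntegrand N M x y s t) =
      (2 * Real.pi * Complex.I)⁻¹ *
        ∮ t in C((1 - N) / 2, N / 2), kernelIntegrand N M x y (conj s) t := by
    intro s
    have h2 : (∮ t in C((1 - N) / 2, N / 2), kernelIntegrand N M x y (conj s) t) =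
        - conj (∮ t in C((1 - N) / 2, N / 2), kernelIntegrand N M x y s t) := by
      rw [circleIntegral, circleIntegral]
      rw [intervalIntegral.integral_of_le (by positivity),
        intervalIntegral.integral_of_le (by positivity), ← integral_conj, ← integral_neg,
        ← intervalIntegral.integral_of_le (by positivity),
        ← intervalIntegral.integral_of_le (by positivity)]
      have h3 := intervalIntegral.integral_comp_sub_left (a := 0) (b := 2 * Real.pi)
        (fun θ : ℝ => deriv (circleMap ((1 - N) / 2) (N / 2)) θ •
          kernelIntegrand N M x y (conj s) (circleMap ((1 - N) / 2) (N / 2) θ)) (2 * Real.pi)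
      simp only [sub_self, sub_zero] at h3
      rw [← h3]
      refine intervalIntegral.integral_congr fun θ _ => ?_
      have h4 : circleMap ((1 - N) / 2) (N / 2) (2 * Real.pi - θ) =
          conj (circleMap ((1 - N) / 2) (N / 2) θ) := by
        simp only [circleMap, map_add, map_mul, ← Complex.exp_conj, map_sub, map_div₀]
        rw [show (((2 * Real.pi - θ : ℝ) : ℂ) * Complex.I) =
          -(θ * Complex.I) + 2 * Real.pi * Complex.I by push_cast; ring, Complex.exp_periodic]
        simp [map_ofNat]
      have h5 : circleMap 0 (N / 2) (2 * Real.pi - θ) = conj (circleMap 0 (N / 2) θ) := by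
        simp only [circleMap, map_add, map_mul, ← Complex.exp_conj]
        rw [show (((2 * Real.pi - θ : ℝ) : ℂ) * Complex.I) =
          -(θ * Complex.I) + 2 * Real.pi * Complex.I by push_cast; ring, Complex.exp_periodic]
        simp [map_ofNat]
      simp only [deriv_circleMap, smul_eq_mul, h4, h5, map_mul, conj_kernelIntegrand,
        Complex.conj_I]
      ring
    rw [h2]
    simp [map_ofNat]
  unfold kernelC
  rw [map_mul, ← integral_conj]
  have h6 : ∀ v : ℝ, conj (((2 * Real.pi * Complex.I)⁻¹ *
      ∮ t in C((1 - N) / 2, N / 2), kernelIntegrand N M x y (1 + v * Complex.I) t) * Complex.I) =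
      - (((2 * Real.pi * Complex.I)⁻¹ *
      ∮ t in C((1 - N) / 2, N / 2),
        kernelIntegrand N M x y (1 + (-v : ℝ) * Complex.I) t) * Complex.I) := by
    intro v
    rw [map_mul, key]
    simp
  simp_rw [h6]
  rw [integral_neg, integral_neg_eq_self (fun v : ℝ => (((2 * Real.pi * Complex.I)⁻¹ *
      ∮ t in C((1 - N) / 2, N / 2),
        kernelIntegrand N M x y (1 + v * Complex.I) t) * Complex.I))]
  simp [map_ofNat]

/-- The correlation kernel of the eigenvalues of `log (Π_M^* Π_M)`, where `Π_M` is a product of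
`M` independent `N × N` complex Ginibre matrices, as a real number; see
`ofReal_kernel`. -/
def kernel (N M : ℕ) (x y : ℝ) : ℝ := (kernelC N M x y).re

/-- Taking the real part in `kernel` loses nothing. -/
lemma ofReal_kernel (N M : ℕ) (x y : ℝ) : (kernel N M x y : ℂ) = kernelC N M x y :=
  Complex.conj_eq_iff_re.mp (conj_kernelC N M x y)

/-- The digamma function `ψ = Γ' / Γ` on the reals. -/
def digamma (u : ℝ) : ℝ := deriv Real.Gamma u / Real.Gamma u

/-- `x_N(k) = N (ψ(1 - k + N) - log N)`. -/
def xN (N k : ℕ) : ℝ := N * (digamma (1 - k + N) - Real.log N)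

/-- `g(k; ξ) = N log N + x_N(k) + ξ √(N / (M + 1))`. -/
def g (N M k : ℕ) (ξ : ℝ) : ℝ := N * Real.log N + xN N k + ξ * √(N / (M + 1))

end GinibreProduct

end

/-!
# Gaps between the eigenvalues of a long product of Ginibre matrices

The diagonal of the kernel splits into `N` explicit "modes". The factor `Γ(t) / Γ(t + N)` is the
reciprocal of `t (t + 1) ⋯ (t + N - 1)`, so the contour integral over `t` is a sum of residues at
`t = -j`, `j < N` (`circleIntegral_kernelIntegrand`), and in the `j`-th term the factor
`Γ(s + N)^(M + 1) / (Γ(s) (s + j))` is a polynomial times `Γ(s + N)^M`. It is therefore holomorphic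
on `Re s > -N`, also at the former pole `s = -j`, and its vertical line of integration can be moved
to `Re s = -j + δ`, with `δ` of either sign (`kernelC_eq_sum_modeDensity`).

On the new line put `s = u - j` and `n = N - j`. The reflection formula turns the integrand into
`e^{-xu} · sin (πu) / (πu) · Γ(1 + j - u) / j! · (Γ(n + u) / Γ(n))^(M + 1)`
(`modeTransform_eq_sinc_mul`), which is nearly the transform of a Gaussian with mean
`(M + 1) ψ(n)` and variance about `(M + 1) / n`. Two bounds make this quantitative: on the real line
`Γ(n + δ) ≤ Γ(n) exp (δ ψ(n) + 4 δ² / n)` (`Gamma_nat_add_le`), and vertically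
`|Γ(x + iv)| ≤ Γ(x) exp (-v² / (64 (r + |v|)))` (`norm_Gamma_le_mul_exp`). With
`|δ| = √(N / (M + 1))`, the reciprocal of the common width of the modes, they give a pointwise
bound of the `j`-th mode by a constant times `|δ| exp (-δ (x - (M + 1) ψ(N - j)))`
(`norm_modeDensity_le_exp`): exponential decay to the right of the mean for `δ > 0`, and to the left
of it for `δ < 0`.

To the right of the mean of mode `k`, all modes `j ≥ k` are bounded with `δ > 0`; the bounds are
summable over `j` since the means are at least `(M + 1) / N = δ⁻²` apart. To the left of the mean
of mode `k - 1`, the finitely many modes `j < k` are bounded with `δ < 0`. Integrating these bounds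
gives a constant times `e^{-C}`, uniformly in `N` and `M`.
-/

namespace GinibreProduct

open Finset Topology

/-! ### Bounds for the Gamma function -/

theorem norm_Gamma_le_Gamma_re {z : ℂ} (hz : 0 < z.re) :
    ‖Complex.Gamma z‖ ≤ Real.Gamma z.re := by
  rw [Complex.Gamma_eq_integral hz, Real.Gamma_eq_integral hz, Complex.GammaIntegral]
  refine (norm_integral_le_integral_norm _).trans_eq ?_
  refine setIntegral_congr_fun measurableSet_Ioi fun x hx => ?_
  have hx : (0 : ℝ) < x := hx
  simp only [norm_mul, Complex.norm_real, Real.norm_eq_abs, abs_of_pos (Real.exp_pos _)]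
  rw [Complex.norm_cpow_eq_rpow_re_of_pos hx]
  simp

/-- The functional equation iterated `L` times, valid as long as none of the factors vanishes. -/
theorem Gamma_add_nat {z : ℂ} {L : ℕ} (hz : ∀ m < L, z + m ≠ 0) :
    Complex.Gamma (z + L) = (∏ m ∈ range L, (z + m)) * Complex.Gamma z := by
  induction L with
  | zero => simp
  | succ L ih =>
    rw [prod_range_succ, Nat.cast_succ, ← add_assoc, Complex.Gamma_add_one _ (hz L (by omega)),
      ih fun m hm => hz m (by omega)]
    ring

theorem real_Gamma_add_nat {x : ℝ} (hx : 0 < x) (L : ℕ) :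
    Real.Gamma (x + L) = (∏ m ∈ range L, (x + m)) * Real.Gamma x := by
  induction L with
  | zero => simp
  | succ L ih =>
    rw [prod_range_succ, Nat.cast_succ, ← add_assoc, Real.Gamma_add_one (by positivity), ih]
    ring

theorem norm_Gamma_mul_prod_le {x : ℝ} (hx : 0 < x) (v : ℝ) (L : ℕ) :
    ‖Complex.Gamma (x + v * Complex.I)‖ * ∏ m ∈ range L, ‖(x + v * Complex.I + m : ℂ)‖ ≤
      Real.Gamma (x + L) := by
  have h1 : Complex.Gamma (x + v * Complex.I + L) =
      (∏ m ∈ range L, (x + v * Complex.I + m)) * Complex.Gamma (x + v * Complex.I) := by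
    refine Gamma_add_nat fun m _ h => ?_
    have := congrArg Complex.re h
    simp at this
    linarith [(Nat.cast_nonneg m : (0 : ℝ) ≤ m)]
  have h2 := norm_Gamma_le_Gamma_re (z := x + v * Complex.I + L) (by simp; positivity)
  rw [h1, norm_mul, norm_prod] at h2
  rw [mul_comm]
  simpa using h2

/-- Decay of `Γ` on vertical lines: Gaussian, with variance of order `r`, for `|v| ≤ r`, and
exponential beyond. The functional equation is iterated `⌈r + |v|⌉` times; each of the factors
`|x + m + iv| / (x + m)` it produces is at least `exp (v² / (64 (r + |v|)²))`. -/
theorem norm_Gamma_le_mul_exp {x r : ℝ} (hx : 0 < x) (hr : 1 ≤ r) (hxr : x ≤ 2 * r) (v : ℝ) :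
    ‖Complex.Gamma (x + v * Complex.I)‖ ≤
      Real.Gamma x * Real.exp (-(v ^ 2 / (64 * (r + |v|)))) := by
  have hv := abs_nonneg v
  set R := r + |v| with hR
  have hR0 : 0 < R := by positivity
  set L := ⌈R⌉₊ with hL
  have hL1 : R ≤ L := Nat.le_ceil _
  have hL2 : (L : ℝ) < R + 1 := Nat.ceil_lt_add_one hR0.le
  set y := v ^ 2 / (4 * R) ^ 2 with hy
  have hy0 : 0 ≤ y := by positivity
  have hy1 : y ≤ 1 := by
    rw [hy, div_le_one (by positivity), ← sq_abs v]
    gcongr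
    linarith
  have hexp : Real.exp (y / 2) ≤ 1 + y := by
    have h1 : Real.exp (y / 2) * (1 - y / 2) ≤ 1 := by
      have := Real.add_one_le_exp (-(y / 2))
      calc Real.exp (y / 2) * (1 - y / 2) ≤ Real.exp (y / 2) * Real.exp (-(y / 2)) := by
            gcongr; linarith
        _ = 1 := by rw [← Real.exp_add]; simp
    nlinarith [Real.exp_pos (y / 2)]
  have hfac : ∀ m ∈ range L, (x + m) * Real.exp (y / 4) ≤ ‖(x + v * Complex.I + m : ℂ)‖ := by
    intro m hm
    have hm' : (m : ℝ) + 1 ≤ L := by exact_mod_cast mem_range.mp hm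
    have hxm : 0 < x + m := by positivity
    have hxm4 : x + m ≤ 4 * R := by linarith
    refine abs_le_of_sq_le_sq' ?_ (norm_nonneg _) |>.2
    have h1 : ‖(x + v * Complex.I + m : ℂ)‖ ^ 2 = (x + m) ^ 2 + v ^ 2 := by
      rw [Complex.sq_norm, Complex.normSq_apply]; simp; ring
    have h2 : Real.exp (y / 4) ^ 2 = Real.exp (y / 2) := by
      rw [← Real.exp_nat_mul]; congr 1; push_cast; ring
    rw [h1, mul_pow, h2]
    have h3 : (x + m) ^ 2 * y ≤ v ^ 2 := by
      rw [hy, mul_div_assoc', div_le_iff₀ (by positivity), mul_comm]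
      gcongr
    nlinarith [sq_nonneg (x + m)]
  have h1 := norm_Gamma_mul_prod_le hx v L
  rw [real_Gamma_add_nat hx] at h1
  have h2 : (∏ m ∈ range L, (x + m)) * Real.exp (y / 4) ^ L ≤
      ∏ m ∈ range L, ‖(x + v * Complex.I + m : ℂ)‖ := by
    calc _ = ∏ m ∈ range L, ((x + m) * Real.exp (y / 4)) := by
          rw [prod_mul_distrib]; simp
      _ ≤ _ := prod_le_prod (fun m _ => by positivity) hfac
  have hP : 0 < ∏ m ∈ range L, (x + m) := prod_pos fun m _ => by positivity
  have h3 : ‖Complex.Gamma (x + v * Complex.I)‖ * Real.exp (y / 4) ^ L ≤ Real.Gamma x := by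
    refine le_of_mul_le_mul_left ?_ hP
    refine le_trans ?_ h1
    calc _ = ‖Complex.Gamma (x + v * Complex.I)‖ *
          ((∏ m ∈ range L, (x + m)) * Real.exp (y / 4) ^ L) := by ring
      _ ≤ _ := by gcongr
  have h4 : Real.exp (v ^ 2 / (64 * R)) ≤ Real.exp (y / 4) ^ L := by
    rw [← Real.exp_nat_mul, Real.exp_le_exp]
    calc v ^ 2 / (64 * R) = R * (y / 4) := by rw [hy]; field_simp; norm_num
      _ ≤ _ := by gcongr
  rw [Real.exp_neg, ← div_eq_mul_inv, le_div_iff₀ (Real.exp_pos _)]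
  exact le_trans (by gcongr) h3

theorem digamma_nat_add_one (n : ℕ) :
    digamma (n + 1) = -Real.eulerMascheroniConstant + harmonic n := by
  rw [digamma, Real.deriv_Gamma_nat, Real.Gamma_nat_eq_factorial,
    mul_div_cancel_left₀ _ (by positivity)]

theorem digamma_nat_succ (n : ℕ) (hn : 1 ≤ n) : digamma (n + 1) = digamma n + 1 / n := by
  obtain ⟨m, rfl⟩ := Nat.exists_eq_add_of_le' hn
  rw [digamma_nat_add_one]
  push_cast
  rw [digamma_nat_add_one, harmonic_succ]
  push_cast
  ring

theorem sub_two_mul_sq_le_log_one_add {x : ℝ} (hx : -(1 / 2) ≤ x) :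
    x - 2 * x ^ 2 ≤ Real.log (1 + x) := by
  have h1 : 0 < 1 + x := by linarith
  refine le_trans ?_ (Real.one_sub_inv_le_log_of_pos h1)
  have : 1 - (1 + x)⁻¹ = x / (1 + x) := by field_simp; ring
  rw [this, le_div_iff₀ h1]
  nlinarith [mul_nonneg (sq_nonneg x) (show 0 ≤ 1 + 2 * x by linarith)]

/-- Second-order upper bound for `log Γ` near an integer. The defect
`log Γ(m + δ) - log Γ(m) - δ ψ(m) - 4 δ² / m` is nondecreasing in `m`, and convexity of `log Γ`
together with `ψ(m) - log m → 0` shows that its limit is at most `0`. -/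
theorem Gamma_nat_add_le {n : ℕ} (hn : 1 ≤ n) {δ : ℝ} (hδ : |δ| ≤ 1 / 2) :
    Real.Gamma (n + δ) ≤ Real.Gamma n * Real.exp (δ * digamma n + 4 * δ ^ 2 / n) := by
  obtain ⟨hδ1, hδ2⟩ := abs_le.mp hδ
  set q : ℕ → ℝ := fun m => Real.log (Real.Gamma (m + δ)) - Real.log (Real.Gamma m) -
    δ * digamma m - 4 * δ ^ 2 / m with hq
  have hpos : ∀ m : ℕ, 1 ≤ m → (1 : ℝ) ≤ m := fun m hm => by exact_mod_cast hm
  have hmono : ∀ m, 1 ≤ m → q m ≤ q (m + 1) := by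
    intro m hm
    have hm1 := hpos m hm
    have e1 : Real.log (Real.Gamma ((m + 1 : ℕ) + δ)) =
        Real.log (m * (1 + δ / m)) + Real.log (Real.Gamma (m + δ)) := by
      rw [show ((m + 1 : ℕ) : ℝ) + δ = (m + δ) + 1 by push_cast; ring,
        Real.Gamma_add_one (by linarith), Real.log_mul (by linarith)
        (Real.Gamma_pos_of_pos (by linarith)).ne']
      congr 2
      field_simp
    have hx : -(1 / 2) ≤ δ / m := by
      rw [le_div_iff₀ (by linarith)]; linarith
    have e2 : Real.log (Real.Gamma (m + 1 : ℕ)) = Real.log m + Real.log (Real.Gamma m) := by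
      rw [Nat.cast_succ, Real.Gamma_add_one (by linarith), Real.log_mul (by linarith)
        (Real.Gamma_pos_of_pos (by linarith)).ne']
    have e3 := sub_two_mul_sq_le_log_one_add hx
    have e4 : Real.log (m * (1 + δ / m)) = Real.log m + Real.log (1 + δ / m) :=
      Real.log_mul (by linarith) (by linarith)
    have e5 : 2 * (δ / m) ^ 2 ≤ 4 * δ ^ 2 / m - 4 * δ ^ 2 / (m + 1) := by
      have : 4 * δ ^ 2 / m - 4 * δ ^ 2 / (m + 1) = 2 * (δ ^ 2 * (2 / (m * (m + 1)))) := by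
        field_simp; ring
      rw [this, div_pow, div_eq_mul_one_div]
      have : 1 / (m : ℝ) ^ 2 ≤ 2 / (m * (m + 1)) := by
        rw [div_le_div_iff₀ (by positivity) (by positivity)]
        nlinarith
      gcongr
    simp only [hq]
    rw [e1, e2, e4, Nat.cast_succ, digamma_nat_succ m hm]
    have : δ * (digamma m + 1 / m) = δ * digamma m + δ / m := by ring
    linarith
  have hmono' : ∀ m, n ≤ m → q n ≤ q m := by
    intro m hm
    induction m, hm using Nat.le_induction with
    | base => exact le_rfl
    | succ m hm ih => exact ih.trans (hmono m (hn.trans hm))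
  have hconv := Real.convexOn_log_Gamma
  have hrec : ∀ {y : ℝ}, 0 < y → (Real.log ∘ Real.Gamma) (y + 1) =
      (Real.log ∘ Real.Gamma) y + Real.log y := by
    intro y hy
    simp only [Function.comp]
    rw [Real.Gamma_add_one hy.ne', Real.log_mul hy.ne' (Real.Gamma_pos_of_pos hy).ne', add_comm]
  have hlim : Tendsto (fun m : ℕ => |δ| * |Real.log m - digamma (m + 1)| +
      |δ| * |Real.log (m + 1 : ℕ) - digamma (m + 1)|) atTop (𝓝 0) := by
    have h1 : Tendsto (fun m : ℕ => Real.log m - digamma (m + 1)) atTop (𝓝 0) := by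
      have := (Real.tendsto_harmonic_sub_log.neg).add_const Real.eulerMascheroniConstant
      simp only [neg_add_cancel] at this
      refine this.congr fun m => ?_
      rw [digamma_nat_add_one]; ring
    have h2 : Tendsto (fun m : ℕ => Real.log (m + 1 : ℕ) - digamma (m + 1)) atTop (𝓝 0) := by
      have := (Real.tendsto_harmonic_sub_log_add_one.neg).add_const Real.eulerMascheroniConstant
      simp only [neg_add_cancel] at this
      refine this.congr fun m => ?_
      rw [digamma_nat_add_one]; push_cast; ring
    simpa using (h1.abs.const_mul |δ|).add (h2.abs.const_mul |δ|)
  have hqn : q n ≤ 0 := by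
    refine ge_of_tendsto hlim ?_
    filter_upwards [eventually_ge_atTop n] with m hm
    refine (hmono' (m + 1) (by omega)).trans ?_
    have hm1 := hpos m (hn.trans hm)
    have hm0 : m ≠ 0 := by omega
    have a1 : 0 ≤ 4 * δ ^ 2 / ((m + 1 : ℕ) : ℝ) := by positivity
    have b1 : 0 ≤ |δ| * |Real.log m - digamma (m + 1)| := by positivity
    have b2 : 0 ≤ |δ| * |Real.log (m + 1 : ℕ) - digamma (m + 1)| := by positivity
    have b3 := (le_abs_self _).trans_eq (abs_mul δ (Real.log m - digamma (m + 1)))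
    have b4 := (le_abs_self _).trans_eq (abs_mul δ (Real.log (m + 1 : ℕ) - digamma (m + 1)))
    simp only [hq]
    rcases lt_trichotomy δ 0 with h0 | h0 | h0
    · have h := Real.BohrMollerup.f_add_nat_le hconv hrec hm0 (x := 1 + δ) (by linarith)
        (by linarith)
      have h' := hrec (y := m) (by linarith)
      simp only [Function.comp] at h h'
      rw [show (m : ℝ) + (1 + δ) = (m + 1 : ℕ) + δ by push_cast; ring] at h
      push_cast at *
      linarith
    · subst h0; simp
    · have h := Real.BohrMollerup.f_add_nat_le hconv hrec (n := m + 1) (by omega) h0 (by linarith)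
      simp only [Function.comp] at h
      push_cast at *
      linarith
  have hn1 := hpos n hn
  have hG := Real.Gamma_pos_of_pos (show (0 : ℝ) < n by linarith)
  have hG' := Real.Gamma_pos_of_pos (show (0 : ℝ) < n + δ by linarith)
  rw [← Real.log_le_log_iff hG' (by positivity), Real.log_mul hG.ne' (Real.exp_ne_zero _),
    Real.log_exp]
  simp only [hq] at hqn
  linarith

theorem norm_sin_le (z : ℂ) : ‖Complex.sin z‖ ≤ ‖z‖ * Real.exp ‖z‖ := by
  have key : ∀ w : ℂ, ‖Complex.exp w - 1‖ ≤ ‖w‖ * Real.exp ‖w‖ := fun w => by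
    simpa using Complex.norm_exp_sub_sum_le_norm_mul_exp w 1
  have h1 := key (-z * Complex.I)
  have h2 := key (z * Complex.I)
  simp only [norm_mul, norm_neg, Complex.norm_I, mul_one] at h1 h2
  have h3 : Complex.sin z = ((Complex.exp (-z * Complex.I) - 1) -
      (Complex.exp (z * Complex.I) - 1)) * Complex.I / 2 := by
    rw [Complex.sin]; ring
  rw [h3, norm_div, norm_mul, Complex.norm_I]
  have h4 := norm_sub_le (Complex.exp (-z * Complex.I) - 1) (Complex.exp (z * Complex.I) - 1)
  simp only [Complex.norm_ofNat, mul_one]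
  linarith

/-! ### Shifting vertical lines of integration -/

/-- `Γ` decays faster than any power on a closed vertical strip in the right half-plane. -/
theorem norm_Gamma_decay {a b : ℝ} (ha : 0 < a) (hab : a ≤ b) (L : ℕ) :
    ∃ B : ℝ, 0 ≤ B ∧ ∀ x ∈ Set.Icc a b, ∀ v : ℝ,
      ‖Complex.Gamma (x + v * Complex.I)‖ * √(1 + v ^ 2) ^ L ≤ B := by
  have hcont : ContinuousOn (fun x : ℝ => Real.Gamma (x + L)) (Set.Icc a b) := by
    intro x hx
    have hxL : 0 < x + L := by linarith [hx.1, (Nat.cast_nonneg L : (0 : ℝ) ≤ L)]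
    have h1 : ContinuousAt Real.Gamma (x + L) :=
      (Real.differentiableAt_Gamma fun m h => by
        linarith [(Nat.cast_nonneg m : (0 : ℝ) ≤ m)]).continuousAt
    exact (ContinuousAt.comp (f := fun x : ℝ => x + L) h1 (by fun_prop)).continuousWithinAt
  obtain ⟨G, hG⟩ := isCompact_Icc.exists_bound_of_continuousOn hcont
  have hG0 : 0 ≤ G := (norm_nonneg _).trans (hG a ⟨le_rfl, hab⟩)
  set e := min a 1 with he
  have he0 : 0 < e := lt_min ha one_pos
  have hea : e ≤ a := min_le_left _ _
  have he1 : e ≤ 1 := min_le_right _ _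
  refine ⟨G / e ^ L, by positivity, fun x hx v => ?_⟩
  have hx0 : 0 < x := ha.trans_le hx.1
  have h1 := norm_Gamma_mul_prod_le hx0 v L
  have h2 : (e * √(1 + v ^ 2)) ^ L ≤ ∏ m ∈ range L, ‖(x + v * Complex.I + m : ℂ)‖ := by
    calc _ = ∏ m ∈ range L, (e * √(1 + v ^ 2)) := by simp
      _ ≤ _ := by
        refine prod_le_prod (fun m _ => by positivity) fun m _ => ?_
        refine abs_le_of_sq_le_sq' ?_ (norm_nonneg _) |>.2
        have h3 : ‖(x + v * Complex.I + m : ℂ)‖ ^ 2 = (x + m) ^ 2 + v ^ 2 := by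
          rw [Complex.sq_norm, Complex.normSq_apply]; simp; ring
        rw [h3, mul_pow, Real.sq_sqrt (by positivity)]
        have h4 : e ^ 2 ≤ (x + m) ^ 2 := by
          have := hx.1
          gcongr
          linarith [(Nat.cast_nonneg m : (0 : ℝ) ≤ m)]
        have h5 : e ^ 2 ≤ 1 := pow_le_one₀ he0.le he1
        nlinarith [sq_nonneg v]
  have h3 := (le_abs_self _).trans (hG x hx)
  rw [le_div_iff₀ (by positivity)]
  calc _ = ‖Complex.Gamma (x + v * Complex.I)‖ * (e * √(1 + v ^ 2)) ^ L := by
        rw [mul_pow]; ring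
    _ ≤ _ := by gcongr
    _ ≤ _ := h1
    _ ≤ _ := h3

theorem integrable_of_norm_le_div_one_add_sq {f : ℝ → ℂ} (hf : Continuous f) {B : ℝ}
    (hB : ∀ v, ‖f v‖ ≤ B / (1 + v ^ 2)) : Integrable f := by
  refine Integrable.mono' (integrable_inv_one_add_sq.const_mul B) hf.aestronglyMeasurable ?_
  exact Eventually.of_forall fun v => by simpa [div_eq_mul_inv] using hB v

/-- Cauchy's theorem on a vertical strip, for an integrand which decays quadratically. -/
theorem integral_vertical_line_eq {f : ℂ → ℂ} {a b B : ℝ} (hab : a ≤ b)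
    (hf : ∀ z : ℂ, z.re ∈ Set.Icc a b → DifferentiableAt ℂ f z)
    (hB : ∀ x ∈ Set.Icc a b, ∀ v : ℝ, ‖f (x + v * Complex.I)‖ ≤ B / (1 + v ^ 2)) :
    ∫ v : ℝ, f (a + v * Complex.I) = ∫ v : ℝ, f (b + v * Complex.I) := by
  have hcont : ∀ x ∈ Set.Icc a b, Continuous fun v : ℝ => f (x + v * Complex.I) := by
    intro x hx
    refine continuous_iff_continuousAt.mpr fun v => ?_
    have h1 := (hf (x + v * Complex.I) (by simpa using hx)).continuousAt
    exact ContinuousAt.comp (f := fun v : ℝ => (x + v * Complex.I : ℂ)) h1 (by fun_prop)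
  have hint : ∀ x ∈ Set.Icc a b, Integrable fun v : ℝ => f (x + v * Complex.I) := fun x hx =>
    integrable_of_norm_le_div_one_add_sq (hcont x hx) (hB x hx)
  have hlim : ∀ x ∈ Set.Icc a b, Tendsto (fun T : ℝ => ∫ v in (-T)..T, f (x + v * Complex.I))
      atTop (𝓝 (∫ v : ℝ, f (x + v * Complex.I))) := fun x hx =>
    intervalIntegral_tendsto_integral (hint x hx) tendsto_neg_atTop_atBot tendsto_id
  have ha : a ∈ Set.Icc a b := ⟨le_rfl, hab⟩
  have hb : b ∈ Set.Icc a b := ⟨hab, le_rfl⟩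
  -- the horizontal sides of the rectangle contribute at most `B / (1 + T²) * (b - a)` each
  have hside : ∀ T : ℝ, ‖∫ x in a..b, f (x + T * Complex.I)‖ ≤ B / (1 + T ^ 2) * (b - a) := by
    intro T
    have := intervalIntegral.norm_integral_le_of_norm_le_const (a := a) (b := b)
      (f := fun x : ℝ => f (x + T * Complex.I)) (C := B / (1 + T ^ 2)) fun x hx => by
        rw [Set.uIoc_of_le hab] at hx
        exact hB x ⟨hx.1.le, hx.2⟩ T
    rwa [abs_of_nonneg (by linarith)] at this
  have hzero : Tendsto (fun T : ℝ => 2 * (B / (1 + T ^ 2) * (b - a))) atTop (𝓝 0) := by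
    have h1 : Tendsto (fun T : ℝ => 1 + T ^ 2) atTop atTop :=
      tendsto_atTop_add_const_left _ _ (tendsto_pow_atTop two_ne_zero)
    simpa using ((h1.const_div_atTop B).mul_const (b - a)).const_mul 2
  have hdiff := (hlim b hb).sub (hlim a ha)
  have hdiff0 : Tendsto (fun T : ℝ => (∫ v in (-T)..T, f (b + v * Complex.I)) -
      ∫ v in (-T)..T, f (a + v * Complex.I)) atTop (𝓝 0) := by
    refine squeeze_zero_norm' (Eventually.of_forall fun T => ?_) hzero
    have h := Complex.integral_boundary_rect_eq_zero_of_differentiableOn f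
      (a + (-T : ℝ) * Complex.I) (b + T * Complex.I) (by
        intro z hz
        refine (hf z ?_).differentiableWithinAt
        have := hz.1
        simpa [Set.uIcc_of_le hab] using this)
    simp only [Complex.add_re, Complex.ofReal_re, Complex.mul_re, Complex.I_re, mul_zero,
      Complex.ofReal_im, Complex.I_im, mul_one, sub_self, add_zero, Complex.add_im, Complex.mul_im,
      zero_add, smul_eq_mul] at h
    have h2 : (∫ v in (-T)..T, f (b + v * Complex.I)) - ∫ v in (-T)..T, f (a + v * Complex.I) =
        Complex.I * ((∫ x in a..b, f (x + (-T : ℝ) * Complex.I)) -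
          ∫ x in a..b, f (x + T * Complex.I)) := by
      linear_combination (-Complex.I) * h + ((∫ v in (-T)..T, f (b + v * Complex.I)) -
        ∫ v in (-T)..T, f (a + v * Complex.I)) * Complex.I_mul_I
    rw [h2, norm_mul, Complex.norm_I, one_mul]
    refine (norm_sub_le _ _).trans ?_
    have h3 := hside T
    have h4 := hside (-T)
    rw [neg_sq] at h4
    linarith
  exact (sub_eq_zero.mp (tendsto_nhds_unique hdiff hdiff0)).symm

/-- The two-sided Laplace transform of the `j`-th mode, in the variable `s` of the kernel and
normalized to be `1` at `s = -j`. It equals `Γ(s + N)^(M + 1) / (Γ(s) (s + j))` up to a constant;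
written as a polynomial times a power of `Γ(s + N)`, it is visibly holomorphic on `Re s > -N`. -/
noncomputable def modeTransform (N M j : ℕ) (s : ℂ) : ℂ :=
  (∏ i ∈ (range N).erase j, (s + i) / ((i : ℂ) - j)) *
    (Complex.Gamma (s + N) / Complex.Gamma ((N : ℂ) - j)) ^ M

theorem differentiableAt_modeTransform {N M j : ℕ} {s : ℂ} (hs : 0 < (s + N).re) :
    DifferentiableAt ℂ (modeTransform N M j) s := by
  have h1 : DifferentiableAt ℂ (fun z => Complex.Gamma (z + N)) s := by
    refine DifferentiableAt.comp (g := Complex.Gamma) s ?_ (by fun_prop)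
    refine Complex.differentiableAt_Gamma _ fun m h => ?_
    rw [h] at hs
    simp at hs
    linarith [(Nat.cast_nonneg m : (0 : ℝ) ≤ m)]
  unfold modeTransform
  refine DifferentiableAt.mul ?_ ((h1.div_const _).pow M)
  refine DifferentiableAt.fun_finsetProd fun i _ => ?_
  fun_prop

theorem norm_modeTransform_le {N M j : ℕ} (hM : 1 ≤ M) {a b : ℝ} (ha : 0 < a + N)
    (hab : a ≤ b) : ∃ B : ℝ, 0 ≤ B ∧ ∀ c ∈ Set.Icc a b, ∀ v : ℝ,
      ‖modeTransform N M j (c + v * Complex.I)‖ ≤ B / (1 + v ^ 2) := by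
  obtain ⟨B₁, hB₁, h1⟩ := norm_Gamma_decay (b := b + N) ha (by linarith) (N + 2)
  obtain ⟨B₂, hB₂, h2⟩ := norm_Gamma_decay (b := b + N) ha (by linarith) 0
  obtain ⟨m, rfl⟩ := Nat.exists_eq_add_of_le' hM
  set R : ℝ := |a| + |b| + N + 1 with hR
  have hR1 : 1 ≤ R := by
    have := abs_nonneg a
    have := abs_nonneg b
    have : (0 : ℝ) ≤ N := Nat.cast_nonneg _
    linarith
  -- one factor `Γ(s + N)` compensates the polynomial, the other `M - 1` are merely bounded
  set P : ℝ := ∏ i ∈ (range N).erase j, ‖(i : ℂ) - j‖ with hP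
  set G : ℝ := ‖Complex.Gamma ((N : ℂ) - j)‖
  refine ⟨R ^ N / P * (B₁ / G * (B₂ / G) ^ m), by positivity, fun c hc v => ?_⟩
  set w := √(1 + v ^ 2) with hw
  have hw2 : w ^ 2 = 1 + v ^ 2 := Real.sq_sqrt (by positivity)
  have hw1 : 1 ≤ w := Real.one_le_sqrt.mpr (by nlinarith [sq_nonneg v])
  have hvw : |v| ≤ w := Real.abs_le_sqrt (by linarith)
  have hcN : c + N ∈ Set.Icc (a + N) (b + N) := ⟨by linarith [hc.1], by linarith [hc.2]⟩
  have hz : (c + v * Complex.I + N : ℂ) = ((c + N : ℝ) : ℂ) + v * Complex.I := by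
    push_cast; ring
  have g1 := h1 _ hcN v
  have g2 := h2 _ hcN v
  simp only [pow_zero, mul_one] at g2
  have hfac : ∏ i ∈ (range N).erase j, ‖(c + v * Complex.I + i : ℂ)‖ ≤ R ^ N * w ^ N := by
    calc _ ≤ ∏ i ∈ (range N).erase j, (R * w) := by
          refine prod_le_prod (fun _ _ => norm_nonneg _) fun i hi => ?_
          have hi : (i : ℝ) ≤ N := by
            exact_mod_cast (mem_range.mp (mem_of_mem_erase hi)).le
          have hca : |c| ≤ |a| + |b| := by
            rw [abs_le]
            constructor
            · linarith [hc.1, neg_abs_le a, abs_nonneg b]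
            · linarith [hc.2, le_abs_self b, abs_nonneg a]
          have : ‖(c + v * Complex.I + i : ℂ)‖ ≤ |c| + |v| + i := by
            refine (norm_add_le _ _).trans ?_
            refine add_le_add ((norm_add_le _ _).trans ?_) ?_ <;> simp
          nlinarith [abs_nonneg a, abs_nonneg b, (Nat.cast_nonneg N : (0 : ℝ) ≤ N)]
      _ = (R * w) ^ #((range N).erase j) := by simp
      _ ≤ (R * w) ^ N := by
          refine pow_le_pow_right₀ (by nlinarith) ?_
          exact (card_le_card (erase_subset _ _)).trans_eq (card_range N)
      _ = _ := mul_pow _ _ _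
  rw [modeTransform, norm_mul, norm_prod, norm_pow, norm_div, hz]
  simp_rw [norm_div]
  rw [prod_div_distrib, ← hP, pow_succ', div_pow, le_div_iff₀ (by positivity), ← hw2]
  have hΓ : ‖Complex.Gamma (((c + N : ℝ) : ℂ) + v * Complex.I)‖ * w ^ N * w ^ 2 ≤ B₁ := by
    rw [mul_assoc, ← pow_add]; exact g1
  calc _ ≤ (R ^ N * w ^ N) / P * (‖Complex.Gamma (((c + N : ℝ) : ℂ) + v * Complex.I)‖ / G *
        (B₂ ^ m / G ^ m)) * w ^ 2 := by
          gcongr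
          
    _ = R ^ N / P * ((‖Complex.Gamma (((c + N : ℝ) : ℂ) + v * Complex.I)‖ * w ^ N * w ^ 2) / G *
        (B₂ ^ m / G ^ m)) := by ring
    _ ≤ _ := by rw [div_pow]; gcongr

/-! ### Decomposition of the diagonal of the kernel into modes -/

/-- Lagrange interpolation of the constant `1` at the nodes `0, -1, …, -N + 1`. -/
theorem sum_prod_erase_div (N : ℕ) (hN : 1 ≤ N) (t : ℂ) :
    ∑ j ∈ range N, ∏ i ∈ (range N).erase j, (t + i) / ((i : ℂ) - j) = 1 := by
  have h := congrArg (Polynomial.eval t) (Lagrange.sum_basis (s := range N)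
    (v := fun i : ℕ => -(i : ℂ)) (fun a _ b _ h => by simpa using h) ⟨0, mem_range.mpr hN⟩)
  rw [Polynomial.eval_finsetSum, Polynomial.eval_one] at h
  rw [← h]
  refine sum_congr rfl fun j _ => ?_
  rw [Lagrange.basis, Polynomial.eval_prod]
  refine prod_congr rfl fun i _ => ?_
  simp [Lagrange.basisDivisor, div_eq_mul_inv]
  ring

theorem neg_mem_ball {N j : ℕ} (hj : j < N) :
    -(j : ℂ) ∈ Metric.ball ((1 - N) / 2 : ℂ) ((N : ℝ) / 2) := by
  have h1 : (j : ℝ) + 1 ≤ N := by exact_mod_cast hj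
  have h0 : (0 : ℝ) ≤ j := Nat.cast_nonneg _
  rw [Metric.mem_ball, Complex.dist_eq,
    show -(j : ℂ) - (1 - N) / 2 = (((N : ℝ) - 1) / 2 - j : ℝ) by push_cast; ring,
    Complex.norm_real, Real.norm_eq_abs, abs_lt]
  constructor <;> linarith

/-- The integral over `t` as the sum of the residues at `t = -j`, `j < N`. -/
theorem circleIntegral_kernelIntegrand {N M : ℕ} (hN : 1 ≤ N) (x : ℝ) {s : ℂ} (hs : s.re = 1) :
    (2 * Real.pi * Complex.I)⁻¹ *
      ∮ t in C((1 - N) / 2, N / 2), kernelIntegrand N M x x s t =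
    ∑ j ∈ range N, Complex.exp (-(x * (s + j))) * modeTransform N M j s := by
  set c : ℂ := (1 - N) / 2
  set R : ℝ := (N : ℝ) / 2 with hR
  have hR0 : 0 ≤ R := by positivity
  have hre : ∀ t ∈ Metric.closedBall c R, t.re ≤ 1 / 2 := by
    intro t ht
    have h1 := (Complex.re_le_norm (t - c)).trans (mem_closedBall_iff_norm.mp ht)
    have h2 : c.re = (1 - N) / 2 := by
      rw [show c = (((1 - N) / 2 : ℝ) : ℂ) by simp [c], Complex.ofReal_re]
    rw [Complex.sub_re, h2] at h1
    linarith
  have hst : ∀ t ∈ Metric.closedBall c R, s - t ≠ 0 := by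
    intro t ht h
    have h1 := hre t ht
    rw [← sub_eq_zero.mp h, hs] at h1
    norm_num at h1
  set G : ℕ → ℂ → ℂ := fun j t => Complex.exp (x * t - x * s) / (s - t) *
    ((Complex.Gamma (t + N))⁻¹ ^ M) * (Complex.Gamma (s + N) ^ (M + 1) / Complex.Gamma s) *
      (∏ i ∈ (range N).erase j, ((i : ℂ) - j))⁻¹ with hG
  have hGd : ∀ j, DifferentiableOn ℂ (G j) (Metric.closedBall c R) := by
    intro j
    have h1 : Differentiable ℂ fun t : ℂ => (Complex.Gamma (t + N))⁻¹ :=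
      Complex.differentiable_one_div_Gamma.comp (differentiable_id.add_const _)
    refine DifferentiableOn.mul_const (DifferentiableOn.mul_const (DifferentiableOn.mul ?_
      (h1.pow M).differentiableOn) _) _
    exact DifferentiableOn.div (by fun_prop) (by fun_prop) hst
  have hpole : ∀ t ∈ Metric.sphere c R, ∀ j ∈ range N, t + j ≠ 0 := by
    intro t ht j hj h
    have h1 := neg_mem_ball (mem_range.mp hj)
    rw [← eq_neg_of_add_eq_zero_left h] at h1
    have h2 : dist t c = R := ht
    have h3 : dist t c < R := h1
    exact h3.ne h2
  -- partial fractions for `Γ(t) / Γ(t + N)`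
  have hcongr : Set.EqOn (fun t => kernelIntegrand N M x x s t)
      (fun t => ∑ j ∈ range N, (t - -(j : ℂ))⁻¹ • G j t) (Metric.sphere c R) := by
    intro t ht
    have hadd : Complex.Gamma (t + N) = (∏ m ∈ range N, (t + m)) * Complex.Gamma t :=
      Gamma_add_nat fun m hm => hpole t ht m (mem_range.mpr hm)
    have hΓ : Complex.Gamma t ≠ 0 := by
      refine Complex.Gamma_ne_zero fun m hm => ?_
      rcases lt_or_ge m N with h | h
      · exact hpole t ht m (mem_range.mpr h) (by rw [hm]; ring)
      · have h1 := ht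
        rw [hm, mem_sphere_iff_norm,
          show -(m : ℂ) - c = -((m - ((N : ℝ) - 1) / 2 : ℝ) : ℂ) by simp only [c]; push_cast; ring,
          norm_neg, Complex.norm_real, Real.norm_eq_abs] at h1
        have h2 : (N : ℝ) ≤ m := by exact_mod_cast h
        rw [abs_of_nonneg (by linarith [(Nat.cast_nonneg N : (0 : ℝ) ≤ N)])] at h1
        linarith
    have hP : ∏ m ∈ range N, (t + m) ≠ 0 := prod_ne_zero_iff.mpr (hpole t ht)
    have hsum : ∑ j ∈ range N, (t + j)⁻¹ * (∏ i ∈ (range N).erase j, ((i : ℂ) - j))⁻¹ =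
        (∏ m ∈ range N, (t + m))⁻¹ := by
      rw [← mul_one (∏ m ∈ range N, (t + m : ℂ))⁻¹, ← sum_prod_erase_div N hN t, mul_sum]
      refine sum_congr rfl fun j hj => ?_
      rw [prod_div_distrib, ← mul_prod_erase _ _ hj]
      have h1 : ∏ i ∈ (range N).erase j, (t + i) ≠ 0 :=
        prod_ne_zero_iff.mpr fun i hi => hpole t ht i (mem_of_mem_erase hi)
      have h2 := hpole t ht j hj
      field_simp
    have e1 : ∀ j ∈ range N, (t - -(j : ℂ))⁻¹ • G j t = (Complex.exp (x * t - x * s) / (s - t) *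
        ((Complex.Gamma (t + N))⁻¹ ^ M) * (Complex.Gamma (s + N) ^ (M + 1) / Complex.Gamma s)) *
        ((t + j)⁻¹ * (∏ i ∈ (range N).erase j, ((i : ℂ) - j))⁻¹) := by
      intro j _
      simp only [hG, smul_eq_mul, sub_neg_eq_add]
      ring
    beta_reduce
    rw [sum_congr rfl e1, ← mul_sum, hsum, kernelIntegrand, div_pow,
      pow_succ (Complex.Gamma (t + N))]
    have e2 : Complex.Gamma t / Complex.Gamma (t + N) = (∏ m ∈ range N, (t + m))⁻¹ := by
      rw [hadd]; field_simp
    rw [← e2]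
    ring
  rw [circleIntegral.integral_congr hR0 hcongr, circleIntegral.integral_fun_sum]
  · rw [mul_sum]
    refine sum_congr rfl fun j hj => ?_
    rw [(hGd j).circleIntegral_sub_inv_smul (neg_mem_ball (mem_range.mp hj)), smul_eq_mul,
      inv_mul_cancel_left₀ Complex.two_pi_I_ne_zero]
    have hsj : ∀ m : ℕ, s + m ≠ 0 := by
      intro m h
      have := congrArg Complex.re h
      simp [hs] at this
      linarith [(Nat.cast_nonneg m : (0 : ℝ) ≤ m)]
    have hΓs : Complex.Gamma s ≠ 0 := Complex.Gamma_ne_zero_of_re_pos (by rw [hs]; norm_num)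
    have hadd : Complex.Gamma (s + N) = (∏ m ∈ range N, (s + m)) * Complex.Gamma s :=
      Gamma_add_nat fun m _ => hsj m
    simp only [hG, modeTransform]
    rw [prod_div_distrib, div_pow, show x * -(j : ℂ) - x * s = -(x * (s + j)) by ring,
      sub_neg_eq_add, show -(j : ℂ) + N = N - j by ring]
    have e : Complex.Gamma (s + N) ^ (M + 1) / Complex.Gamma s = Complex.Gamma (s + N) ^ M *
        ((s + j) * ∏ m ∈ (range N).erase j, (s + m)) := by
      rw [mul_prod_erase _ (fun m : ℕ => s + (m : ℂ)) hj, pow_succ, mul_div_assoc]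
      congr 1
      rw [hadd]
      field_simp
    rw [e, inv_pow]
    have := hsj j
    field_simp
  · intro j hj
    refine ContinuousOn.circleIntegrable hR0 ?_
    refine ContinuousOn.smul (ContinuousOn.inv₀ (f := fun t : ℂ => t - -(j : ℂ))
      (by fun_prop) fun t ht => ?_)
      ((hGd j).continuousOn.mono Metric.sphere_subset_closedBall)
    rw [sub_neg_eq_add]
    exact hpole t ht j hj

/-- The `j`-th mode, as an inverse Laplace transform over the line `Re s = -j + δ`. For `M ≥ 1` its
value does not depend on `δ`, as long as `0 < δ - j + N`; the parameter selects the line on which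
it is estimated. -/
noncomputable def modeDensity (N M j : ℕ) (δ x : ℝ) : ℂ :=
  (2 * Real.pi : ℂ)⁻¹ * ∫ v : ℝ, Complex.exp (-(x * (δ + v * Complex.I))) *
    modeTransform N M j (((δ - j : ℝ) : ℂ) + v * Complex.I)

theorem norm_exp_mul_modeTransform (N M j : ℕ) (x c v : ℝ) :
    ‖Complex.exp (-(x * (c + v * Complex.I + j))) * modeTransform N M j (c + v * Complex.I)‖ =
      Real.exp (-(x * (c + j))) * ‖modeTransform N M j (c + v * Complex.I)‖ := by
  rw [norm_mul, Complex.norm_exp]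
  simp

theorem continuous_modeTransform_line {N M j : ℕ} {c : ℝ} (hc : 0 < c + N) :
    Continuous fun v : ℝ => modeTransform N M j (c + v * Complex.I) := by
  refine continuous_iff_continuousAt.mpr fun v => ?_
  have h1 := (differentiableAt_modeTransform (N := N) (M := M) (j := j)
    (s := c + v * Complex.I) (by simpa using hc)).continuousAt
  exact ContinuousAt.comp (f := fun v : ℝ => (c + v * Complex.I : ℂ)) h1 (by fun_prop)

theorem integrable_modeTransform_line {N M j : ℕ} (hM : 1 ≤ M) {c : ℝ} (hc : 0 < c + N) :
    Integrable fun v : ℝ => modeTransform N M j (c + v * Complex.I) := by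
  obtain ⟨B, -, hB⟩ := norm_modeTransform_le (j := j) hM hc le_rfl
  exact integrable_of_norm_le_div_one_add_sq (continuous_modeTransform_line hc)
    (hB c ⟨le_rfl, le_rfl⟩)

theorem integral_mode_shift {N M j : ℕ} (hM : 1 ≤ M) {c : ℝ} (hc : 0 < c + N) (hc1 : c ≤ 1)
    (x : ℝ) :
    ∫ v : ℝ, Complex.exp (-(x * (((c : ℝ) : ℂ) + v * Complex.I + j))) *
      modeTransform N M j (((c : ℝ) : ℂ) + v * Complex.I) =
    ∫ v : ℝ, Complex.exp (-(x * (((1 : ℝ) : ℂ) + v * Complex.I + j))) *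
      modeTransform N M j (((1 : ℝ) : ℂ) + v * Complex.I) := by
  obtain ⟨B, hB0, hB⟩ := norm_modeTransform_le (j := j) hM hc hc1
  refine integral_vertical_line_eq (B := Real.exp (|x| * (|c| + 1 + j)) * B)
    (f := fun s => Complex.exp (-(x * (s + j))) * modeTransform N M j s) hc1 ?_ ?_
  · intro z hz
    refine DifferentiableAt.mul (by fun_prop) (differentiableAt_modeTransform ?_)
    simp
    linarith [hz.1]
  · intro y hy v
    rw [norm_exp_mul_modeTransform, mul_div_assoc]
    have h1 := hB y hy v
    have h2 : -(x * (y + j)) ≤ |x| * (|c| + 1 + j) := by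
      have h3 : |y + j| ≤ |c| + 1 + j := by
        have : (0 : ℝ) ≤ j := Nat.cast_nonneg _
        rw [abs_le]
        constructor
        · linarith [hy.1, neg_abs_le c]
        · linarith [hy.2, abs_nonneg c]
      calc -(x * (y + j)) ≤ |x * (y + j)| := neg_le_abs _
        _ = |x| * |y + j| := abs_mul _ _
        _ ≤ _ := by gcongr
    gcongr

/-- The diagonal of the kernel is the sum of the modes, each of them taken on a line of its own. -/
theorem kernelC_eq_sum_modeDensity {N M : ℕ} (hN : 1 ≤ N) (hM : 1 ≤ M) (δ : ℕ → ℝ)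
    (hδ : ∀ j < N, |δ j| < 1) (x : ℝ) :
    kernelC N M x x = ∑ j ∈ range N, modeDensity N M j (δ j) x := by
  have hre : ∀ v : ℝ, (1 + v * Complex.I : ℂ).re = 1 := fun v => by simp
  have hint : ∀ j ∈ range N, Integrable fun v : ℝ => Complex.exp (-(x * (1 + v * Complex.I + j))) *
      modeTransform N M j (1 + v * Complex.I) := by
    intro j _
    have h1N : (0 : ℝ) < 1 + N := by positivity
    have h1 := integrable_modeTransform_line (j := j) hM h1N
    simp only [Complex.ofReal_one] at h1
    refine h1.bdd_mul (c := Real.exp (-(x * (1 + j)))) (by fun_prop) ?_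
    refine Eventually.of_forall fun v => ?_
    rw [Complex.norm_exp]
    simp
  unfold kernelC
  simp_rw [circleIntegral_kernelIntegrand hN x (hre _)]
  rw [integral_mul_const, integral_finsetSum _ hint, sum_mul, mul_sum]
  refine sum_congr rfl fun j hj => ?_
  have hjN : (j : ℝ) + 1 ≤ N := by exact_mod_cast mem_range.mp hj
  obtain ⟨h1, h2⟩ := abs_lt.mp (hδ j (mem_range.mp hj))
  have hshift := integral_mode_shift (N := N) (j := j) hM (c := δ j - j) (by linarith)
    (by linarith [(Nat.cast_nonneg j : (0 : ℝ) ≤ j)]) x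
  simp only [Complex.ofReal_one] at hshift
  rw [← hshift, modeDensity]
  have hI := Complex.I_ne_zero
  have e : ∀ v : ℝ, (((δ j - j : ℝ) : ℂ) + v * Complex.I + j) = δ j + v * Complex.I := by
    intro v; push_cast; ring
  simp_rw [e]
  field_simp

theorem norm_modeDensity_le {N M j : ℕ} (δ x : ℝ) :
    ‖modeDensity N M j δ x‖ ≤ (2 * Real.pi)⁻¹ * Real.exp (-(δ * x)) *
      ∫ v : ℝ, ‖modeTransform N M j (((δ - j : ℝ) : ℂ) + v * Complex.I)‖ := by
  rw [modeDensity, norm_mul, mul_assoc, ← integral_const_mul]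
  have e : ‖(2 * Real.pi : ℂ)⁻¹‖ = (2 * Real.pi)⁻¹ := by
    rw [norm_inv, norm_mul, Complex.norm_real, Real.norm_of_nonneg Real.pi_pos.le]; simp
  rw [e]
  refine mul_le_mul_of_nonneg_left ?_ (by positivity)
  refine (norm_integral_le_integral_norm _).trans_eq ?_
  refine integral_congr_ae (Eventually.of_forall fun v => ?_)
  simp only [norm_mul, Complex.norm_exp]
  simp [mul_comm]

theorem stronglyMeasurable_modeDensity {N M j : ℕ} {δ : ℝ} (hδ : 0 < δ - j + N) :
    StronglyMeasurable (modeDensity N M j δ) := by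
  unfold modeDensity
  refine StronglyMeasurable.const_mul ?_ _
  refine StronglyMeasurable.integral_prod_right (f := fun x v : ℝ =>
    Complex.exp (-(x * (δ + v * Complex.I))) *
    modeTransform N M j (((δ - j : ℝ) : ℂ) + v * Complex.I)) ?_
  refine Continuous.stronglyMeasurable ?_
  have h1 := (continuous_modeTransform_line (N := N) (M := M) (j := j) hδ).comp
    (continuous_snd (X := ℝ) (Y := ℝ))
  refine Continuous.mul (by fun_prop) h1

/-! ### Exponential bounds for a single mode -/

theorem prod_erase_sub {N j : ℕ} (hj : j < N) :
    ∏ i ∈ (range N).erase j, ((i : ℂ) - j) =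
      (-1) ^ j * j.factorial * Complex.Gamma ((N : ℂ) - j) := by
  obtain ⟨r, rfl⟩ := Nat.exists_eq_add_of_lt hj
  have h1 : ∏ i ∈ (range (j + r + 1)).erase j, ((i : ℂ) - j) =
      ∏ i ∈ range (j + 1 + r), if i = j then 1 else ((i : ℂ) - j) := by
    rw [show j + 1 + r = j + r + 1 by omega, ← mul_prod_erase _ _ (mem_range.mpr hj)]
    rw [if_pos rfl, one_mul]
    exact prod_congr rfl fun i hi => by rw [if_neg (ne_of_mem_erase hi)]
  rw [h1, prod_range_add, prod_range_succ, if_pos rfl, mul_one]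
  congr 1
  · rw [← prod_range_reflect, ← prod_range_add_one_eq_factorial]
    push_cast
    rw [show ((-1 : ℂ)) ^ j = ∏ _i ∈ range j, (-1 : ℂ) by simp, ← prod_mul_distrib]
    refine prod_congr rfl fun i hi => ?_
    have hi := mem_range.mp hi
    rw [if_neg (by omega), Nat.sub_sub, Nat.cast_sub (by omega)]
    push_cast
    ring
  · rw [show ((j + r + 1 : ℕ) : ℂ) - j = r + 1 by push_cast; ring, Complex.Gamma_nat_eq_factorial,
      ← prod_range_add_one_eq_factorial]
    push_cast
    refine prod_congr rfl fun i _ => ?_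
    rw [if_neg (by omega)]
    ring

/-- By the reflection formula, `modeTransform` near `s = -j` is `sin (πu) / (πu)` times values of
`Γ` at points with positive real part, where the norm of `Γ` is easily bounded. -/
theorem modeTransform_eq_sinc_mul {N M j : ℕ} (hj : j < N) {u : ℂ} (h0 : u.re ≠ 0)
    (h1 : |u.re| < 1) :
    modeTransform N M j (u - j) =
      Complex.sin (Real.pi * u) / (Real.pi * u) *
        (Complex.Gamma (1 + j - u) / j.factorial) *
        (Complex.Gamma ((N : ℂ) - j + u) / Complex.Gamma ((N : ℂ) - j)) ^ (M + 1) := by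
  obtain ⟨h2, h3⟩ := abs_lt.mp h1
  have hu : u ≠ 0 := fun h => h0 (by rw [h]; rfl)
  -- `u` is not an integer, its real part lying strictly between two consecutive integers
  have hint : ∀ m : ℤ, u ≠ m := by
    intro m hm
    rw [hm, Complex.intCast_re] at h0 h2 h3
    have a1 : -1 < m := by exact_mod_cast h2
    have a2 : m < 1 := by exact_mod_cast h3
    exact h0 (by rw [show m = 0 by omega]; simp)
  have hs : ∀ m : ℕ, u - j + m ≠ 0 := by
    intro m h
    refine hint (j - m) ?_
    push_cast
    linear_combination h
  have hΓ : Complex.Gamma (u - j) ≠ 0 := Complex.Gamma_ne_zero fun m h => hs m (by rw [h]; ring)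
  have hadd := Gamma_add_nat (z := u - j) (L := N) fun m _ => hs m
  rw [← mul_prod_erase _ (fun m : ℕ => u - j + (m : ℂ)) (mem_range.mpr hj), sub_add_cancel] at hadd
  have hrefl := Complex.Gamma_mul_Gamma_one_sub (u - j)
  have hsin : Complex.sin (Real.pi * (u - j)) = (-1) ^ j * Complex.sin (Real.pi * u) := by
    rw [mul_sub, mul_comm (Real.pi : ℂ) (j : ℂ), Complex.sin_antiperiodic.sub_nat_mul_eq]
  have hsin0 : Complex.sin (Real.pi * u) ≠ 0 := by
    intro h
    obtain ⟨m, hm⟩ := Complex.sin_eq_zero_iff.mp h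
    refine hint m ?_
    have : (Real.pi : ℂ) ≠ 0 := by exact_mod_cast Real.pi_ne_zero
    exact mul_left_cancel₀ this (by rw [hm]; ring)
  rw [hsin, show 1 - (u - j) = 1 + j - u by ring] at hrefl
  have hpi : (Real.pi : ℂ) ≠ 0 := by exact_mod_cast Real.pi_ne_zero
  have hΓn : Complex.Gamma ((N : ℂ) - j) ≠ 0 := by
    refine Complex.Gamma_ne_zero_of_re_pos ?_
    have : (j : ℝ) < N := by exact_mod_cast hj
    simpa using this
  have hfac : (j.factorial : ℂ) ≠ 0 := by exact_mod_cast j.factorial_ne_zero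
  have hP : ∏ m ∈ (range N).erase j, (u - j + m : ℂ) =
      Complex.Gamma (u - j + N) * ((-1) ^ j * Complex.sin (Real.pi * u) *
        Complex.Gamma (1 + j - u) / (Real.pi * u)) := by
    rw [eq_div_iff (mul_ne_zero (by simp) hsin0)] at hrefl
    rw [hadd]
    generalize Complex.sin (Real.pi * u) = S at hrefl ⊢
    field_simp
    linear_combination (-(∏ m ∈ (range N).erase j, (u - j + m : ℂ))) * hrefl
  rw [modeTransform, prod_div_distrib, prod_erase_sub hj, hP, pow_succ,
    show u - j + N = N - j + u by ring]
  generalize (Complex.Gamma ((N : ℂ) - j + u) / Complex.Gamma ((N : ℂ) - j)) ^ M = Q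
  field_simp

/-- The decay of `Γ` beats the growth `e^{4v}` of the sine, and leaves a factor `e^{-σv/2}` whose
integral is of the order of the reciprocal width `1 / σ`. -/
theorem gaussian_exponent_le {σ N v : ℝ} (hσ : 128 ≤ σ) (hN : 1 ≤ N) (hv : 0 ≤ v) :
    4 * v - σ ^ 2 * N * (v ^ 2 / (64 * (N + v))) ≤ 32 - σ / 2 * v := by
  have hD : 0 < N + v := by linarith
  have hmain : σ * v - 32 ≤ σ ^ 2 * N * (v ^ 2 / (64 * (N + v))) := by
    rw [mul_div_assoc', le_div_iff₀ (by positivity)]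
    rcases le_total v N with h | h
    · have h1 : (σ * v - 32) * (64 * (N + v)) ≤ (σ * v) ^ 2 / 128 * (64 * (N + v)) := by
        gcongr
        nlinarith [sq_nonneg (σ * v - 64)]
      have h2 : (σ * v) ^ 2 / 128 * (64 * (N + v)) ≤ (σ * v) ^ 2 / 128 * (64 * (N + N)) := by
        gcongr
      nlinarith
    · have h1 : (σ * v - 32) * (64 * (N + v)) ≤ (σ * v) * (64 * (v + v)) := by
        gcongr
        linarith
      have h2 : (σ * v) * (64 * (v + v)) ≤ σ ^ 2 * N * v ^ 2 := by
        calc (σ * v) * (64 * (v + v)) = σ * 128 * 1 * v ^ 2 := by ring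
          _ ≤ σ * σ * N * v ^ 2 := by gcongr
          _ = _ := by ring
      linarith
  nlinarith

theorem integral_exp_neg_mul_abs {c : ℝ} (hc : 0 < c) :
    ∫ v : ℝ, Real.exp (-c * |v|) = 2 / c := by
  rw [integral_comp_abs (f := fun v => Real.exp (-c * v)), integral_exp_mul_Ioi (by linarith)]
  simp
  field_simp

theorem integrable_exp_neg_mul_abs {c : ℝ} (hc : 0 < c) :
    Integrable fun v : ℝ => Real.exp (-c * |v|) := by
  -- a function whose integral is nonzero is integrable
  refine not_imp_comm.1 integral_undef ?_
  rw [integral_exp_neg_mul_abs hc]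
  positivity

theorem integral_norm_modeTransform_le {N M j : ℕ} (hj : j < N) {δ A : ℝ}
    (hδ0 : δ ≠ 0) (hδ : |δ| ≤ 1 / 128) (hvar : (M + 1) * δ ^ 2 = N)
    (hA : Real.Gamma (1 + j - δ) ≤ A * j.factorial) :
    ∫ v : ℝ, ‖modeTransform N M j (((δ - j : ℝ) : ℂ) + v * Complex.I)‖ ≤
      4 * |δ| * A * Real.exp (33 + (M + 1) * δ * digamma (N - j : ℕ) + 4 * N / (N - j : ℕ)) := by
  obtain ⟨hδ1, hδ2⟩ := abs_le.mp hδ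
  have hδpos : 0 < |δ| := abs_pos.mpr hδ0
  set n := N - j with hn
  have hn1 : 1 ≤ n := by omega
  have hn1' : (1 : ℝ) ≤ n := by exact_mod_cast hn1
  have hnN : (n : ℝ) ≤ N := by exact_mod_cast Nat.sub_le N j
  have hnC : (N : ℂ) - j = n := by rw [hn, Nat.cast_sub hj.le]
  have hj0 : (0 : ℝ) ≤ j := Nat.cast_nonneg _
  have hΓn : 0 < Real.Gamma n := Real.Gamma_pos_of_pos (by linarith)
  set E := Real.exp (33 + (M + 1) * δ * digamma n + 4 * N / n) with hE
  set σ := |δ|⁻¹ with hσ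
  have hσ128 : 128 ≤ σ := by
    rw [hσ, le_inv_comm₀ (by norm_num) hδpos]; linarith
  have hσ2 : σ ^ 2 * N = M + 1 := by
    rw [hσ, inv_pow, sq_abs, ← hvar]
    field_simp
  have hA0 : 0 ≤ A := by
    have h1 : 0 < Real.Gamma (1 + j - δ) := Real.Gamma_pos_of_pos (by linarith)
    exact (pos_of_mul_pos_left (h1.trans_le hA) (by positivity)).le
  have hbound : ∀ v : ℝ, ‖modeTransform N M j (((δ - j : ℝ) : ℂ) + v * Complex.I)‖ ≤
      A * E * Real.exp (-(σ / 2) * |v|) := by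
    intro v
    set u : ℂ := δ + v * Complex.I with hu
    have hre : u.re = δ := by simp [hu]
    have hu0 : u ≠ 0 := fun h => hδ0 (by rw [← hre, h]; rfl)
    have hunorm : ‖u‖ ≤ |δ| + |v| := by
      refine (norm_add_le _ _).trans ?_
      simp
    rw [show (((δ - j : ℝ) : ℂ) + v * Complex.I) = u - j by rw [hu]; push_cast; ring,
      modeTransform_eq_sinc_mul hj (by rwa [hre]) (by rw [hre]; linarith), norm_mul, norm_mul,
      norm_pow]
    have f1 : ‖Complex.sin (Real.pi * u) / (Real.pi * u)‖ ≤ Real.exp (1 + 4 * |v|) := by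
      have h1 := norm_sin_le (Real.pi * u)
      have h2 : 0 < ‖(Real.pi * u : ℂ)‖ := by
        rw [norm_mul, Complex.norm_real, Real.norm_of_nonneg Real.pi_pos.le]
        exact mul_pos Real.pi_pos (norm_pos_iff.mpr hu0)
      rw [norm_div, div_le_iff₀ h2, mul_comm (Real.exp _)]
      refine h1.trans (mul_le_mul_of_nonneg_left (Real.exp_le_exp.mpr ?_) h2.le)
      rw [norm_mul, Complex.norm_real, Real.norm_of_nonneg Real.pi_pos.le]
      have := Real.pi_le_four
      calc Real.pi * ‖u‖ ≤ 4 * (|δ| + |v|) := by gcongr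
        _ ≤ _ := by linarith
    have f2 : ‖Complex.Gamma (1 + j - u) / j.factorial‖ ≤ A := by
      have h1 := norm_Gamma_le_Gamma_re (z := 1 + j - u) (by simp [hre]; linarith)
      have h2 : (1 + j - u).re = 1 + j - δ := by simp [hre]
      rw [h2] at h1
      rw [norm_div, Complex.norm_natCast, div_le_iff₀ (by positivity)]
      exact h1.trans hA
    have f3 : ‖Complex.Gamma ((N : ℂ) - j + u) / Complex.Gamma ((N : ℂ) - j)‖ ≤
        Real.exp (δ * digamma n + 4 * δ ^ 2 / n + -(v ^ 2 / (64 * (N + |v|)))) := by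
      have h1 := norm_Gamma_le_mul_exp (x := n + δ) (r := N) (by linarith) (by linarith)
        (by linarith) v
      have h2 := Gamma_nat_add_le hn1 (δ := δ) (by linarith)
      have h3 : ‖Complex.Gamma ((N : ℂ) - j)‖ = Real.Gamma n := by
        rw [hnC, ← Complex.ofReal_natCast, Complex.Gamma_ofReal, Complex.norm_real,
          Real.norm_of_nonneg hΓn.le]
      rw [norm_div, h3, div_le_iff₀ hΓn, Real.exp_add]
      rw [show (N : ℂ) - j + u = ((n + δ : ℝ) : ℂ) + v * Complex.I by
        rw [hnC, hu]; push_cast; ring]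
      refine h1.trans ?_
      calc _ ≤ Real.Gamma n * Real.exp (δ * digamma n + 4 * δ ^ 2 / n) *
            Real.exp (-(v ^ 2 / (64 * (N + |v|)))) := by gcongr
        _ = _ := by ring
    have f3' := pow_le_pow_left₀ (norm_nonneg _) f3 (M + 1)
    rw [← Real.exp_nat_mul] at f3'
    calc _ ≤ Real.exp (1 + 4 * |v|) * A * Real.exp (((M + 1 : ℕ) : ℝ) *
          (δ * digamma n + 4 * δ ^ 2 / n + -(v ^ 2 / (64 * (N + |v|))))) := by gcongr
      _ = A * Real.exp (1 + 4 * |v| + ((M + 1 : ℕ) : ℝ) *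
          (δ * digamma n + 4 * δ ^ 2 / n + -(v ^ 2 / (64 * (N + |v|))))) := by
        rw [Real.exp_add (1 + 4 * |v|)]; ring
      _ ≤ A * Real.exp (33 + (M + 1) * δ * digamma n + 4 * N / n + -(σ / 2) * |v|) := by
        refine mul_le_mul_of_nonneg_left (Real.exp_le_exp.mpr ?_) hA0
        have h1 := gaussian_exponent_le hσ128 (hn1'.trans hnN) (abs_nonneg v)
        rw [hσ2, sq_abs] at h1
        have h2 : (M + 1 : ℝ) * (4 * δ ^ 2 / n) = 4 * N / n := by
          rw [← hvar]; ring
        push_cast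
        linarith
      _ = _ := by rw [Real.exp_add, hE]; ring
  have hσ0 : 0 < σ / 2 := by linarith
  calc _ ≤ ∫ v : ℝ, A * E * Real.exp (-(σ / 2) * |v|) :=
        integral_mono_of_nonneg (Eventually.of_forall fun _ => norm_nonneg _)
          ((integrable_exp_neg_mul_abs hσ0).const_mul _) (Eventually.of_forall hbound)
    _ = _ := by
      rw [integral_const_mul, integral_exp_neg_mul_abs hσ0, hσ]
      field_simp
      ring

/-- The `j`-th mode decays exponentially, at the scale of its width `|δ|⁻¹`, on the side of its mean
`(M + 1) ψ(N - j)` given by the sign of `δ`. -/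
theorem norm_modeDensity_le_exp {N M j : ℕ} (hj : j < N) {δ A : ℝ}
    (hδ0 : δ ≠ 0) (hδ : |δ| ≤ 1 / 128) (hvar : (M + 1) * δ ^ 2 = N)
    (hA : Real.Gamma (1 + j - δ) ≤ A * j.factorial) (x : ℝ) :
    ‖modeDensity N M j δ x‖ ≤ A * |δ| *
      Real.exp (33 - δ * (x - (M + 1) * digamma (N - j : ℕ)) + 4 * N / (N - j : ℕ)) := by
  have h := norm_modeDensity_le (N := N) (M := M) (j := j) δ x
  refine h.trans ?_
  have h1 := integral_norm_modeTransform_le hj hδ0 hδ hvar hA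
  have hA0 : 0 ≤ A := by
    have h1 : 0 < Real.Gamma (1 + j - δ) :=
      Real.Gamma_pos_of_pos (by linarith [(abs_le.mp hδ).2, (Nat.cast_nonneg j : (0 : ℝ) ≤ j)])
    exact (pos_of_mul_pos_left (h1.trans_le hA) (by positivity)).le
  have hpi : (2 * Real.pi)⁻¹ ≤ 1 / 4 := by
    rw [inv_eq_one_div]
    gcongr
    linarith [Real.pi_gt_three]
  calc _ ≤ 1 / 4 * Real.exp (-(δ * x)) * (4 * |δ| * A * Real.exp (33 +
        (M + 1) * δ * digamma (N - j : ℕ) + 4 * N / (N - j : ℕ))) := by gcongr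
    _ = A * |δ| * (Real.exp (-(δ * x)) * Real.exp (33 +
        (M + 1) * δ * digamma (N - j : ℕ) + 4 * N / (N - j : ℕ))) := by ring
    _ = _ := by
      rw [← Real.exp_add]
      congr 2
      ring

/-! ### Summation over the modes -/

theorem digamma_nat_monotone {m n : ℕ} (hm : 1 ≤ m) (hmn : m ≤ n) : digamma m ≤ digamma n := by
  induction n, hmn using Nat.le_induction with
  | base => exact le_rfl
  | succ n hn ih =>
    rw [Nat.cast_succ, digamma_nat_succ n (hm.trans hn)]
    have : (0 : ℝ) ≤ 1 / n := by positivity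
    linarith

theorem le_mul_digamma_sub {N n d : ℕ} (hn : 1 ≤ n) (hd : n + d ≤ N) :
    (d : ℝ) ≤ N * (digamma (n + d : ℕ) - digamma n) := by
  induction d with
  | zero => simp
  | succ d ih =>
    have h1 := ih (by omega)
    have h2 := digamma_nat_succ (n + d) (by omega)
    rw [← add_assoc, Nat.cast_succ (n + d), h2, Nat.cast_succ d]
    have h3 : (1 : ℝ) ≤ N * (1 / (n + d : ℕ)) := by
      have : (0 : ℝ) < (n + d : ℕ) := by exact_mod_cast (by omega : 0 < n + d)
      rw [mul_one_div, le_div_iff₀ this, one_mul]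
      exact_mod_cast (by omega : n + d ≤ N)
    linarith

/-- The spacing of the means of the modes. The term `N / n` is the spacing next to the mean with
parameter `n`; it absorbs the error `4 N / n` of the second-order bound, which is not uniform
in `n`. -/
theorem half_add_le_mul_digamma_sub {N n d : ℕ} (hn : 1 ≤ n) (hd : n + d ≤ N) (hd1 : 1 ≤ d) :
    (d + N / n : ℝ) / 2 ≤ N * (digamma (n + d : ℕ) - digamma n) := by
  obtain ⟨e, rfl⟩ := Nat.exists_eq_add_of_le' hd1
  have h1 := le_mul_digamma_sub (N := N) (n := n + 1) (d := e) (by omega) (by omega)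
  rw [show n + 1 + e = n + (e + 1) by ring, Nat.cast_succ n, digamma_nat_succ n hn] at h1
  have hn0 : (0 : ℝ) < n := by exact_mod_cast hn
  have h2 : (1 : ℝ) ≤ N / n := by
    rw [le_div_iff₀ hn0, one_mul]
    exact_mod_cast (by omega : n ≤ N)
  have h3 : (N : ℝ) * (1 / n) = N / n := by ring
  have h4 : (0 : ℝ) ≤ e := Nat.cast_nonneg e
  push_cast at *
  linarith

theorem Gamma_one_add_sub_le_of_pos (j : ℕ) {δ : ℝ} (h0 : 0 < δ) (h1 : δ ≤ 1 / 128) :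
    Real.Gamma (1 + j - δ) ≤ Real.exp 1 * j.factorial := by
  have h := Gamma_nat_add_le (n := j + 1) (by omega) (δ := -δ)
    (by rw [abs_neg, abs_of_pos h0]; linarith)
  rw [show ((j + 1 : ℕ) : ℝ) + -δ = 1 + j - δ by push_cast; ring] at h
  push_cast at h
  rw [Real.Gamma_nat_eq_factorial, digamma_nat_add_one] at h
  refine h.trans ?_
  rw [mul_comm]
  gcongr
  have e1 := Real.eulerMascheroniConstant_lt_two_thirds
  have e2 : (0 : ℝ) ≤ harmonic j := by
    rw [harmonic]; push_cast; positivity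
  have e3 : 4 * (-δ) ^ 2 / ((j : ℝ) + 1) ≤ 4 * δ ^ 2 := by
    rw [neg_sq]
    exact div_le_self (by positivity) (by linarith [(Nat.cast_nonneg j : (0 : ℝ) ≤ j)])
  nlinarith

theorem Gamma_one_add_sub_le_of_neg (j : ℕ) {δ : ℝ} (h0 : δ < 0) (h1 : -(1 / 128) ≤ δ) :
    Real.Gamma (1 + j - δ) ≤ Real.exp (j + 1) * j.factorial := by
  have h := Gamma_nat_add_le (n := j + 1) (by omega) (δ := -δ)
    (by rw [abs_neg, abs_of_neg h0]; linarith)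
  rw [show ((j + 1 : ℕ) : ℝ) + -δ = 1 + j - δ by push_cast; ring] at h
  push_cast at h
  rw [Real.Gamma_nat_eq_factorial, digamma_nat_add_one] at h
  refine h.trans ?_
  rw [mul_comm]
  refine mul_le_mul_of_nonneg_right (Real.exp_le_exp.mpr ?_) (by positivity)
  have e1 := Real.one_half_lt_eulerMascheroniConstant
  have e2 : (harmonic j : ℝ) ≤ j := by
    rw [harmonic]
    push_cast
    calc ∑ i ∈ range j, ((i : ℝ) + 1)⁻¹ ≤ ∑ i ∈ range j, (1 : ℝ) :=
          sum_le_sum fun i _ => inv_le_one_of_one_le₀ (by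
            linarith [(Nat.cast_nonneg i : (0 : ℝ) ≤ i)])
      _ = j := by simp
  have e3 : 4 * (-δ) ^ 2 / ((j : ℝ) + 1) ≤ 4 * δ ^ 2 := by
    rw [neg_sq]
    exact div_le_self (by positivity) (by linarith [(Nat.cast_nonneg j : (0 : ℝ) ≤ j)])
  have e4 : (0 : ℝ) ≤ j := Nat.cast_nonneg j
  nlinarith

theorem sum_exp_neg_le_two (n : ℕ) : ∑ d ∈ range n, Real.exp (-(d : ℝ)) ≤ 2 := by
  have h0 : Real.exp (-1) ≤ 1 / 2 := by
    rw [Real.exp_neg, inv_eq_one_div]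
    gcongr
    linarith [Real.add_one_le_exp 1]
  calc ∑ d ∈ range n, Real.exp (-(d : ℝ)) ≤ ∑ d ∈ range n, (1 / 2 : ℝ) ^ d := by
        refine sum_le_sum fun d _ => ?_
        rw [show -(d : ℝ) = d * (-1) by ring, Real.exp_nat_mul]
        gcongr
    _ ≤ 2 := sum_geometric_two_le n

/-- The modes `j ≥ k` to the right of the mean of mode `k`. -/
theorem sum_norm_modeDensity_upper_le {N M k : ℕ} (hk : 2 * k < N) {δ : ℝ}
    (hδ0 : 0 < δ) (hδ : δ ≤ 1 / 128) (hvar : (M + 1) * δ ^ 2 = N) (x : ℝ) :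
    ∑ j ∈ Ico k N, ‖modeDensity N M j δ x‖ ≤
      2 * Real.exp 42 * δ * Real.exp (-δ * (x - (M + 1) * digamma (N - k : ℕ))) := by
  set a := (M + 1) * digamma (N - k : ℕ) with ha
  have hterm : ∀ d ∈ range (N - k), ‖modeDensity N M (k + d) δ x‖ ≤
      Real.exp 42 * δ * Real.exp (-δ * (x - a)) * Real.exp (-(d : ℝ)) := by
    intro d hd
    have hd := mem_range.mp hd
    refine (norm_modeDensity_le_exp (j := k + d) (by omega) hδ0.ne' (by rwa [abs_of_pos hδ0]) hvar
      (Gamma_one_add_sub_le_of_pos (k + d) hδ0 hδ) x).trans ?_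
    rw [abs_of_pos hδ0]
    rw [show Real.exp 42 * δ * Real.exp (-δ * (x - a)) * Real.exp (-(d : ℝ)) =
      Real.exp 1 * δ * Real.exp (41 + -δ * (x - a) + -d) by
        rw [show (42 : ℝ) = 1 + 41 by norm_num, Real.exp_add, Real.exp_add, Real.exp_add]; ring]
    refine mul_le_mul_of_nonneg_left (Real.exp_le_exp.mpr ?_) (by positivity)
    set n := N - (k + d) with hn
    have hn1 : 1 ≤ n := by omega
    have hn0 : (0 : ℝ) < n := by exact_mod_cast hn1
    have hnd : N - k = n + d := by omega
    rcases Nat.eq_zero_or_pos d with h0 | h0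
    · subst h0
      have h1 : (N : ℝ) ≤ 2 * n := by exact_mod_cast (by omega : N ≤ 2 * n)
      have h2 : 4 * (N : ℝ) / n ≤ 8 := by rw [div_le_iff₀ hn0]; linarith
      rw [add_zero] at hnd
      rw [ha, hnd]
      simp
      linarith
    · have h1 := half_add_le_mul_digamma_sub (N := N) hn1 (by omega) h0
      rw [← hnd] at h1
      -- `δ (M + 1) = N / δ ≥ 128 N`
      have h2 : 128 * N * (digamma (N - k : ℕ) - digamma n) ≤
          δ * (M + 1) * (digamma (N - k : ℕ) - digamma n) := by
        refine mul_le_mul_of_nonneg_right ?_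
          (sub_nonneg.mpr (digamma_nat_monotone hn1 (by omega)))
        rw [← hvar]
        have : 128 * δ ≤ 1 := by linarith
        nlinarith [mul_nonneg (mul_nonneg (by positivity : (0 : ℝ) ≤ M + 1) hδ0.le)
          (sub_nonneg.mpr this)]
      have h3 : (0 : ℝ) ≤ d := Nat.cast_nonneg d
      have h4 : (0 : ℝ) ≤ N / n := by positivity
      have h5 : 4 * (N : ℝ) / n = 4 * (N / n) := by ring
      rw [ha, h5]
      linarith
  rw [sum_Ico_eq_sum_range]
  refine (sum_le_sum hterm).trans ?_
  rw [← mul_sum]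
  calc _ ≤ Real.exp 42 * δ * Real.exp (-δ * (x - a)) * 2 := by
        gcongr
        exact sum_exp_neg_le_two _
    _ = _ := by ring

/-- The modes `j < k` to the left of the mean of mode `k - 1`. -/
theorem sum_norm_modeDensity_lower_le {N M k : ℕ} (hk : 2 * k < N) {δ : ℝ}
    (hδ0 : 0 < δ) (hδ : δ ≤ 1 / 128) (hvar : (M + 1) * δ ^ 2 = N) (x : ℝ) :
    ∑ j ∈ range k, ‖modeDensity N M j (-δ) x‖ ≤
      k * Real.exp (k + 41) * δ * Real.exp (δ * (x - (M + 1) * digamma (N + 1 - k : ℕ))) := by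
  have hterm : ∀ j ∈ range k, ‖modeDensity N M j (-δ) x‖ ≤
      Real.exp (k + 41) * δ * Real.exp (δ * (x - (M + 1) * digamma (N + 1 - k : ℕ))) := by
    intro j hj
    have hj := mem_range.mp hj
    have hjk : (j : ℝ) + 1 ≤ k := by exact_mod_cast hj
    refine (norm_modeDensity_le_exp (by omega) (by linarith)
      (by rwa [abs_neg, abs_of_pos hδ0]) (by rwa [neg_sq])
      (Gamma_one_add_sub_le_of_neg j (by linarith) (by linarith)) x).trans ?_
    rw [abs_neg, abs_of_pos hδ0, mul_comm (Real.exp _) δ, mul_comm (Real.exp _) δ, mul_assoc,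
      mul_assoc, ← Real.exp_add, ← Real.exp_add]
    refine mul_le_mul_of_nonneg_left (Real.exp_le_exp.mpr ?_) hδ0.le
    have hn0 : (0 : ℝ) < (N - j : ℕ) := by exact_mod_cast (by omega : 0 < N - j)
    have h1 : (N : ℝ) ≤ 2 * (N - j : ℕ) := by exact_mod_cast (by omega : N ≤ 2 * (N - j))
    have h2 : 4 * (N : ℝ) / (N - j : ℕ) ≤ 8 := by rw [div_le_iff₀ hn0]; linarith
    have h3 : digamma (N + 1 - k : ℕ) ≤ digamma (N - j : ℕ) :=
      digamma_nat_monotone (by omega) (by omega)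
    have h4 : δ * (M + 1) * digamma (N + 1 - k : ℕ) ≤ δ * (M + 1) * digamma (N - j : ℕ) := by
      gcongr
    linarith
  refine (sum_le_sum hterm).trans_eq ?_
  rw [sum_const, card_range, nsmul_eq_mul]
  ring

theorem kernelC_eq_sum_lower_add_sum_upper {N M k : ℕ} (hk : k < N) (hM : 1 ≤ M) {δ : ℝ}
    (hδ0 : 0 < δ) (hδ : δ ≤ 1 / 128) (x : ℝ) :
    kernelC N M x x = ∑ j ∈ range k, modeDensity N M j (-δ) x +
      ∑ j ∈ Ico k N, modeDensity N M j δ x := by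
  have habs : ∀ j < N, |if j < k then -δ else δ| < 1 := by
    intro j _
    split_ifs
    · rw [abs_neg, abs_of_pos hδ0]; linarith
    · rw [abs_of_pos hδ0]; linarith
  rw [kernelC_eq_sum_modeDensity (by omega) hM (fun j => if j < k then -δ else δ) habs x,
    ← sum_range_add_sum_Ico _ hk.le]
  congr 1
  · exact sum_congr rfl fun j hj => by rw [if_pos (mem_range.mp hj)]
  · exact sum_congr rfl fun j hj => by rw [if_neg (by simpa using (mem_Ico.mp hj).1)]

theorem measurable_kernel_diag {N M k : ℕ} (hk : k < N) (hM : 1 ≤ M) {δ : ℝ}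
    (hδ0 : 0 < δ) (hδ : δ ≤ 1 / 128) : StronglyMeasurable fun x => kernel N M x x := by
  simp_rw [kernel, kernelC_eq_sum_lower_add_sum_upper hk hM hδ0 hδ]
  have hpos : ∀ j < N, (1 : ℝ) ≤ N - j := by
    intro j hj
    have : (j : ℝ) + 1 ≤ N := by exact_mod_cast hj
    linarith
  refine Complex.continuous_re.comp_stronglyMeasurable (StronglyMeasurable.add ?_ ?_)
  · refine Finset.stronglyMeasurable_fun_sum _ fun j hj => stronglyMeasurable_modeDensity ?_
    linarith [hpos j ((mem_range.mp hj).trans hk)]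
  · refine Finset.stronglyMeasurable_fun_sum _ fun j hj => stronglyMeasurable_modeDensity ?_
    linarith [hpos j (mem_Ico.mp hj).2]

theorem abs_kernel_diag_le {N M k : ℕ} (hk : 2 * k < N) (hM : 1 ≤ M) {δ : ℝ}
    (hδ0 : 0 < δ) (hδ : δ ≤ 1 / 128) (hvar : (M + 1) * δ ^ 2 = N) (x : ℝ) :
    |kernel N M x x| ≤
      k * Real.exp (k + 41) * δ * Real.exp (δ * (x - (M + 1) * digamma (N + 1 - k : ℕ))) +
      2 * Real.exp 42 * δ * Real.exp (-δ * (x - (M + 1) * digamma (N - k : ℕ))) := by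
  have h1 : |kernel N M x x| ≤ ‖kernelC N M x x‖ := Complex.abs_re_le_norm _
  rw [kernelC_eq_sum_lower_add_sum_upper (k := k) (by omega) hM hδ0 hδ] at h1
  refine h1.trans ((norm_add_le _ _).trans (add_le_add ?_ ?_))
  · exact (norm_sum_le _ _).trans (sum_norm_modeDensity_lower_le hk hδ0 hδ hvar x)
  · exact (norm_sum_le _ _).trans (sum_norm_modeDensity_upper_le hk hδ0 hδ hvar x)

theorem kernel_integral_Ioi_le {N M : ℕ} (hN : 1 ≤ N) (hM : 1 ≤ M) {δ : ℝ}
    (hδ0 : 0 < δ) (hδ : δ ≤ 1 / 128) (hvar : (M + 1) * δ ^ 2 = N) (C : ℝ) :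
    IntegrableOn (fun x => kernel N M x x) (Set.Ioi ((M + 1) * digamma N + C / δ)) ∧
      ∫ x in Set.Ioi ((M + 1) * digamma N + C / δ), kernel N M x x ≤
        2 * Real.exp 42 * Real.exp (-C) := by
  set a := (M + 1) * digamma N with ha
  have hbound : ∀ x, |kernel N M x x| ≤ 2 * Real.exp 42 * δ * Real.exp (δ * a) *
      Real.exp (-δ * x) := by
    intro x
    refine (abs_kernel_diag_le (k := 0) (by omega) hM hδ0 hδ hvar x).trans_eq ?_
    simp only [Nat.cast_zero, zero_mul, zero_add, Nat.sub_zero]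
    rw [mul_assoc _ (Real.exp (δ * a)), ← Real.exp_add]
    congr 2
    ring
  have hdom : IntegrableOn (fun x => 2 * Real.exp 42 * δ * Real.exp (δ * a) * Real.exp (-δ * x))
      (Set.Ioi (a + C / δ)) :=
    (integrableOn_exp_mul_Ioi (by linarith) _).const_mul _
  have hint : IntegrableOn (fun x => kernel N M x x) (Set.Ioi (a + C / δ)) :=
    hdom.mono' (measurable_kernel_diag (k := 0) (by omega) hM hδ0 hδ).aestronglyMeasurable
      (Eventually.of_forall hbound)
  refine ⟨hint, ?_⟩
  calc _ ≤ ∫ x in Set.Ioi (a + C / δ), 2 * Real.exp 42 * δ * Real.exp (δ * a) *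
        Real.exp (-δ * x) :=
        integral_mono hint hdom fun x => (le_abs_self _).trans (hbound x)
    _ = 2 * Real.exp 42 * (Real.exp (δ * a) * Real.exp (-δ * (a + C / δ))) := by
      rw [integral_const_mul, integral_exp_mul_Ioi (by linarith)]
      field_simp
    _ = _ := by
      rw [← Real.exp_add]
      congr 2
      field_simp
      ring

theorem kernel_intervalIntegral_le {N M k : ℕ} (hk : 2 * k < N) (hM : 1 ≤ M) {δ : ℝ}
    (hδ0 : 0 < δ) (hδ : δ ≤ 1 / 128) (hvar : (M + 1) * δ ^ 2 = N) {C a b : ℝ}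
    (ha : a = (M + 1) * digamma (N - k : ℕ) + C / δ)
    (hb : b = (M + 1) * digamma (N + 1 - k : ℕ) - C / δ) (hab : a ≤ b) :
    IntervalIntegrable (fun x => kernel N M x x) volume a b ∧
      ∫ x in a..b, kernel N M x x ≤
        (k * Real.exp (k + 41) + 2 * Real.exp 42) * Real.exp (-C) := by
  set p := (M + 1) * digamma (N - k : ℕ)
  set q := (M + 1) * digamma (N + 1 - k : ℕ)
  have hbound := fun x => abs_kernel_diag_le hk hM hδ0 hδ hvar x
  have hdom : ∀ f : ℝ → ℝ, Continuous f → IntervalIntegrable f volume a b :=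
    fun f hf => hf.intervalIntegrable _ _
  set F₁ : ℝ → ℝ := fun x => k * Real.exp (k + 41) * δ * Real.exp (δ * (x - q)) with hF₁
  set F₂ : ℝ → ℝ := fun x => 2 * Real.exp 42 * δ * Real.exp (-δ * (x - p)) with hF₂
  have hd₁ : IntervalIntegrable F₁ volume a b := hdom _ (by fun_prop)
  have hd₂ : IntervalIntegrable F₂ volume a b := hdom _ (by fun_prop)
  have hint : IntervalIntegrable (fun x => kernel N M x x) volume a b :=
    (hd₁.add hd₂).mono_fun'
      (measurable_kernel_diag (k := k) (by omega) hM hδ0 hδ).aestronglyMeasurable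
      (Eventually.of_forall hbound)
  refine ⟨hint, ?_⟩
  have hprim : ∀ c r : ℝ, c ≠ 0 → ∫ x in a..b, Real.exp (c * (x - r)) =
      (Real.exp (c * (b - r)) - Real.exp (c * (a - r))) / c := by
    intro c r hc
    have hderiv : ∀ x ∈ Set.uIcc a b, HasDerivAt (fun x => Real.exp (c * (x - r)) / c)
        (Real.exp (c * (x - r))) x := by
      intro x _
      have := ((((hasDerivAt_id x).sub_const r).const_mul c).exp).div_const c
      simpa [hc] using this
    rw [intervalIntegral.integral_eq_sub_of_hasDerivAt hderiv (hdom _ (by fun_prop))]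
    ring
  calc ∫ x in a..b, kernel N M x x ≤ ∫ x in a..b, F₁ x + F₂ x :=
        intervalIntegral.integral_mono_on hab hint (hd₁.add hd₂) fun x _ =>
          (le_abs_self _).trans (hbound x)
    _ = k * Real.exp (k + 41) * (Real.exp (δ * (b - q)) - Real.exp (δ * (a - q))) +
        2 * Real.exp 42 * (Real.exp (-δ * (a - p)) - Real.exp (-δ * (b - p))) := by
      rw [intervalIntegral.integral_add hd₁ hd₂, hF₁, hF₂]
      simp only [intervalIntegral.integral_const_mul]
      rw [hprim δ q hδ0.ne', hprim (-δ) p (by linarith)]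
      field_simp
      ring
    _ ≤ k * Real.exp (k + 41) * Real.exp (δ * (b - q)) +
        2 * Real.exp 42 * Real.exp (-δ * (a - p)) := by
      gcongr
      · linarith [Real.exp_pos (δ * (a - q))]
      · linarith [Real.exp_pos (-δ * (b - p))]
    _ = _ := by
      have e1 : δ * (b - q) = -C := by rw [hb]; field_simp; ring
      have e2 : -δ * (a - p) = -C := by rw [ha]; field_simp; ring
      rw [e1, e2]
      ring

/-- In the scale of the kernel, `g` is the mean of mode `k - 1` shifted by `ξ` widths. -/
theorem scaled_g {N M k : ℕ} (hN : 1 ≤ N) (hk : k ≤ N) (ξ : ℝ) :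
    ((M : ℝ) + 1) / N * g N M k ξ =
      (M + 1) * digamma (N + 1 - k : ℕ) + ξ / √(N / (M + 1)) := by
  have hN0 : (0 : ℝ) < N := by exact_mod_cast hN
  have hM0 : (0 : ℝ) < M + 1 := by positivity
  have hq : (0 : ℝ) < N / (M + 1) := by positivity
  rw [g, xN, Nat.cast_sub (by omega), show (1 : ℝ) - k + N = (N + 1 : ℕ) - k by push_cast; ring]
  have h1 : √((N : ℝ) / (M + 1)) ≠ 0 := (Real.sqrt_pos.mpr hq).ne'
  have h2 : ((M : ℝ) + 1) / N * (ξ * √(N / (M + 1))) = ξ / √(N / (M + 1)) := by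
    rw [eq_div_iff h1]
    calc _ = ((M : ℝ) + 1) / N * ξ * (√(N / (M + 1)) * √(N / (M + 1))) := by ring
      _ = _ := by rw [Real.mul_self_sqrt hq.le]; field_simp
  rw [mul_add, h2]
  congr 1
  field_simp
  ring

theorem exists_mul_exp_neg_lt (K : ℝ) {ε : ℝ} (hε : 0 < ε) :
    ∃ C : ℝ, 0 < C ∧ K * Real.exp (-C) < ε := by
  have h : Tendsto (fun C : ℝ => K * Real.exp (-C)) atTop (𝓝 0) := by
    simpa using (Real.tendsto_exp_neg_atTop_nhds_zero).const_mul K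
  obtain ⟨C, h1, h2⟩ := ((h.eventually (gt_mem_nhds hε)).and (eventually_gt_atTop 0)).exists
  exact ⟨C, h2, h1⟩

/-- If `M / N → ∞`, then `δ = √(N / (M + 1))` is eventually as small as desired, and
`(M + 1) δ² = N`. -/
theorem eventually_small_width {M : ℕ → ℕ}
    (hM : Tendsto (fun N : ℕ => (M N : ℝ) / N) atTop atTop) {η : ℝ} (hη : 0 < η) :
    ∀ᶠ N : ℕ in atTop, 1 ≤ M N ∧ 0 < √((N : ℝ) / (M N + 1)) ∧ √((N : ℝ) / (M N + 1)) ≤ η ∧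
      ((M N : ℝ) + 1) * √((N : ℝ) / (M N + 1)) ^ 2 = N := by
  filter_upwards [hM.eventually_ge_atTop (1 / η ^ 2), hM.eventually_gt_atTop 0,
    eventually_ge_atTop 1] with N h1 h2 hN
  have hN0 : (0 : ℝ) < N := by exact_mod_cast hN
  have hM0 : (0 : ℝ) < M N := by
    rcases div_pos_iff.mp h2 with h | h
    · exact h.1
    · linarith [h.2]
  have hq : (0 : ℝ) < N / (M N + 1) := by positivity
  refine ⟨by exact_mod_cast hM0, Real.sqrt_pos.mpr hq, ?_, ?_⟩
  · rw [Real.sqrt_le_left hη.le, div_le_iff₀ (by positivity)]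
    rw [div_le_div_iff₀ (by positivity) hN0] at h1
    nlinarith [sq_nonneg η]
  · rw [Real.sq_sqrt hq.le]
    field_simp

end GinibreProduct

theorem theorem2p1 (ε : ℝ) (hε : 0 < ε) :
    (∃ C₀ : ℝ, 0 < C₀ ∧
      ∀ M : ℕ → ℕ, Tendsto (fun N : ℕ => (M N : ℝ) / N) atTop atTop →
        ∀ᶠ N : ℕ in atTop,
          IntegrableOn (fun x : ℝ => GinibreProduct.kernel N (M N) x x)
            (Set.Ioi (((M N : ℝ) + 1) / N * GinibreProduct.g N (M N) 1 C₀)) ∧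
          (∫ x in Set.Ioi (((M N : ℝ) + 1) / N * GinibreProduct.g N (M N) 1 C₀),
            GinibreProduct.kernel N (M N) x x) < ε) ∧
    (∀ k : ℕ, 1 ≤ k → ∃ Cₖ : ℝ, 0 < Cₖ ∧
      ∀ M : ℕ → ℕ, Tendsto (fun N : ℕ => (M N : ℝ) / N) atTop atTop →
        ∀ᶠ N : ℕ in atTop,
          IntervalIntegrable (fun x : ℝ => GinibreProduct.kernel N (M N) x x) volume
            (((M N : ℝ) + 1) / N * GinibreProduct.g N (M N) (k + 1) Cₖ)
            (((M N : ℝ) + 1) / N * GinibreProduct.g N (M N) k (-Cₖ)) ∧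
          (∫ x in (((M N : ℝ) + 1) / N * GinibreProduct.g N (M N) (k + 1) Cₖ)..(((M N : ℝ) + 1)
              / N * GinibreProduct.g N (M N) k (-Cₖ)),
            GinibreProduct.kernel N (M N) x x) < ε) := by
  open GinibreProduct in
  refine ⟨?_, fun k hk => ?_⟩
  · obtain ⟨C, hC, hCε⟩ := exists_mul_exp_neg_lt (2 * Real.exp 42) hε
    refine ⟨C, hC, fun M hM => ?_⟩
    filter_upwards [eventually_small_width hM (show (0 : ℝ) < 1 / 128 by norm_num),
      eventually_ge_atTop 1] with N ⟨hM1, hδ0, hδ, hvar⟩ hN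
    rw [scaled_g hN hN, Nat.add_sub_cancel]
    obtain ⟨h1, h2⟩ := kernel_integral_Ioi_le hN hM1 hδ0 hδ hvar C
    exact ⟨h1, h2.trans_lt hCε⟩
  · obtain ⟨C, hC, hCε⟩ :=
      exists_mul_exp_neg_lt (k * Real.exp (k + 41) + 2 * Real.exp 42) hε
    refine ⟨C, hC, fun M hM => ?_⟩
    filter_upwards [eventually_small_width hM (show (0 : ℝ) < 1 / 128 by norm_num),
      eventually_small_width hM (show (0 : ℝ) < 1 / (2 * C) by positivity),
      eventually_gt_atTop (2 * k)] with N ⟨hM1, hδ0, hδ, hvar⟩ ⟨_, _, hδC, _⟩ hN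
    have hN0 : (0 : ℝ) < N := by exact_mod_cast (by omega : 0 < N)
    rw [scaled_g (by omega) (by omega), scaled_g (by omega) (by omega),
      show N + 1 - (k + 1) = N - k by omega]
    set δ := √((N : ℝ) / (M N + 1))
    obtain ⟨h1, h2⟩ := kernel_intervalIntegral_le (k := k) hN hM1 hδ0 hδ hvar (C := C) rfl rfl (by
      -- consecutive modes are at distance at least `(M + 1) / N = δ⁻² ≥ 2 C / δ`
      have hn1 : 1 ≤ N - k := by omega
      have hn0 : (0 : ℝ) < (N - k : ℕ) := by exact_mod_cast hn1
      rw [show N + 1 - k = N - k + 1 by omega, Nat.cast_succ, digamma_nat_succ _ hn1]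
      have hnN : ((N - k : ℕ) : ℝ) ≤ N := by exact_mod_cast Nat.sub_le N k
      have e1 : 2 * (C / δ) ≤ ((M N : ℝ) + 1) * (1 / N) := by
        rw [← hvar]
        have : (M N : ℝ) + 1 ≠ 0 := by positivity
        rw [mul_one_div, div_mul_cancel_left₀ this, mul_div_assoc', div_le_iff₀ hδ0]
        rw [le_div_iff₀ (by positivity)] at hδC
        field_simp
        linarith
      have e2 : ((M N : ℝ) + 1) * (1 / N) ≤ (M N + 1) * (1 / (N - k : ℕ)) := by gcongr
      linarith)
    simp only [neg_div, ← sub_eq_add_neg]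
    exact ⟨h1, h2.trans_lt hCε⟩
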